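/- Let $\mathfrak h$ be a finite dimensional complex vector space, $G\subset GL(\mathfrak h)$ a finite subgroup, $S\subset G$ the set of complex reflections (elements $s$ with $\operatorname{rank}(s-1)=1$), and $c:S\to\mathbb C$ a $G$-invariant function. For $s\in S$ let $\alpha_s\in\mathfrak h^*$ be nonzero and vanish on the fixed hyperplane of $s$ in $\mathfrak h$, let $\alpha_s^\vee\in\mathfrak h$ vanish on the fixed hyperplane of $s$ in $\mathfrak h^*$, with $(\alpha_s,\alpha_s^\vee)=2$, and let $\lambda_s\neq 1$ be the nontrivial eigenvalue of $s$ in $\mathfrak h^*$. Let $H=H_{1,c}(\mathfrak h,G)$ be the rational Cherednik algebra: the $\mathbb C$-algebra generated by $G,\mathfrak h,\mathfrak h^*$ with the relations $gxg^{-1}={}^gx$, $gyg^{-1}={}^gy$, $[x,x']=[y,y']=0$ and $$[y,x]=(y,x)-\sum_{s\in S}c_s\,(y,\alpha_s)(x,\alpha_s^\vee)\,s\qquad(x,x'\in\mathfrak h^*,\ y,y'\in\mathfrak h,\ g\in G),$$ with the increasing filtration $F^\bullet$ given by $\deg G=\deg\mathfrak h^*=0$, $\deg\mathfrak h=1$.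 Let $\widetilde H=\widetilde H_{1,c}(\mathfrak h,G)$ be its completion at $0\in\mathfrak h$: $\widetilde H=\bigcup_n F^n\widetilde H$, where $F^n\widetilde H=\mathbb C[[\mathfrak h]]\otimes_{\mathbb C[\mathfrak h]}F^nH$ is the completion of $F^nH$ with respect to the ideal of $0$ in $\mathbb C[\mathfrak h]$ (acting from the left), with the multiplication extended by continuity. For a basis $y_i$ of $\mathfrak h$ with dual basis $x_i$ put $\mathbf h=\sum_i x_iy_i+\frac12\dim\mathfrak h-\sum_{s\in S}\frac{2c_s}{1-\lambda_s}s\in H$. Category $\mathcal O_H$ consists of the $H$-modules $M$ that are direct sums of finite dimensional generalized eigenspaces of $\mathbf h$, with the real parts of the eigenvalues of $\mathbf h$ bounded from below. For such $M$ let $\widetilde M$ be the completion of $M$ by the grading by generalized eigenvalues of $\mathbf h$ (that is, with respect to the subspaces spanned by the generalized eigenspaces with real part of the eigenvalue $\ge r$, $r\in\mathbb R$); the action of $H$ on $M$ extends by continuity to an action of $\widetilde H$ on $\widetilde M$. Category $\mathcal O_{\widetilde H}$ is the full subcategory of the category of $\widetilde H$-modules formed by the modules isomorphic to $\widetilde M$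 for some $M\in\mathcal O_H$. Then $\mathcal O_{\widetilde H}$ coincides with the full subcategory of $\widetilde H$-modules that are finitely generated over $\mathbb C[[\mathfrak h]]$: an $\widetilde H$-module is isomorphic to $\widetilde M$ for some $M\in\mathcal O_H$ if and only if it is finitely generated over $\mathbb C[[\mathfrak h]]$. -/

import Mathlib

universe u v w

namespace Cherednik

section Reflections

variable {V : Type u} [AddCommGroup V] [Module ℂ V]

/-- The contragredient action of a linear automorphism `g` on `V*`: `(g x)(v) = x (g⁻¹ v)`. -/
def dualAct (g : V ≃ₗ[ℂ] V) : Module.Dual ℂ V →ₗ[ℂ] Module.Dual ℂ V :=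
  (g⁻¹ : V ≃ₗ[ℂ] V).toLinearMap.dualMap

theorem dualAct_apply (g : V ≃ₗ[ℂ] V) (x : Module.Dual ℂ V) (v : V) :
    dualAct g x v = x (g⁻¹ v) := rfl

variable (G : Subgroup (V ≃ₗ[ℂ] V))

/-- The set of complex reflections in `G`: the elements `s` with `rank (s - 1) = 1`
(for elements of finite order: exactly one eigenvalue, with multiplicity, differs from `1`). -/
def reflections : Set G :=
  {s | Module.finrank ℂ (LinearMap.range ((s : V ≃ₗ[ℂ] V).toLinearMap - LinearMap.id)) = 1}

/-- A `G`-invariant function `c : S → ℂ` on the set `S` of complex reflections of `G`. -/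
structure Parameter where
  toFun : reflections G → ℂ
  invariant : ∀ s s' : reflections G, IsConj (s : G) (s' : G) → toFun s = toFun s'

variable {G}

theorem reflection_form (s : reflections G) : ∃ (w : V) (β : Module.Dual ℂ V),
    w ≠ 0 ∧ β ≠ 0 ∧ ∀ v, (s.1.1 : V ≃ₗ[ℂ] V) v = v + β v • w := by
  obtain ⟨⟨w, hw⟩, hw0, hspan⟩ := finrank_eq_one_iff'.1 s.2
  have hw0' : w ≠ 0 := fun h => hw0 (Subtype.ext h)
  set T := (s.1.1 : V ≃ₗ[ℂ] V).toLinearMap - LinearMap.id with hT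
  have hmem : ∀ v, ∃ a : ℂ, a • w = T v := fun v => by
    obtain ⟨a, ha⟩ := hspan ⟨T v, LinearMap.mem_range_self T v⟩
    exact ⟨a, congrArg Subtype.val ha⟩
  choose a ha using hmem
  have hinj : ∀ p q : ℂ, p • w = q • w → p = q := fun p q h => smul_left_injective ℂ hw0' h
  let β : Module.Dual ℂ V :=
    { toFun := a
      map_add' := fun x y => hinj _ _ (by rw [ha, add_smul, ha, ha, map_add])
      map_smul' := fun r x => hinj _ _ (by
        rw [ha, RingHom.id_apply, smul_eq_mul, mul_smul, ha, map_smul]) }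
  have hβ : ∀ v, β v • w = T v := ha
  have key : ∀ v, (s.1.1 : V ≃ₗ[ℂ] V) v = v + β v • w := fun v => by
    rw [hβ]; simp [hT]
  refine ⟨w, β, hw0', ?_, key⟩
  rintro h0
  obtain ⟨v, hv⟩ := hw
  rw [← hβ, h0] at hv
  exact hw0' (by simpa using hv.symm)

theorem reflection_inv (s : V ≃ₗ[ℂ] V) (v : V) : s (s⁻¹ v) = v := s.apply_symm_apply v

theorem reflection_inv' (s : V ≃ₗ[ℂ] V) (v : V) : s⁻¹ (s v) = v := s.symm_apply_apply v

theorem conj_mem (g : G) (s : reflections G) : g * s.1 * g⁻¹ ∈ reflections G := by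
  have hs : Module.finrank ℂ _ = 1 := s.2
  show Module.finrank ℂ _ = 1
  rw [← hs]
  have hr : LinearMap.range (((g * s.1 * g⁻¹ : G) : V ≃ₗ[ℂ] V).toLinearMap - LinearMap.id) =
      (LinearMap.range ((s.1 : V ≃ₗ[ℂ] V).toLinearMap - LinearMap.id)).map
        (g : V ≃ₗ[ℂ] V).toLinearMap := by
    ext v
    simp only [LinearMap.mem_range, Submodule.mem_map]
    constructor
    · rintro ⟨u, rfl⟩
      refine ⟨_, ⟨(g : V ≃ₗ[ℂ] V)⁻¹ u, rfl⟩, ?_⟩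
      simp
    · rintro ⟨_, ⟨u, rfl⟩, rfl⟩
      refine ⟨(g : V ≃ₗ[ℂ] V) u, ?_⟩
      simp
  rw [hr]
  exact LinearEquiv.finrank_map_eq (g : V ≃ₗ[ℂ] V) _

variable [Finite G]

theorem exists_root (s : reflections G) :
    ∃ (α : Module.Dual ℂ V) (αv : V) (l : ℂ), α ≠ 0 ∧ (∀ v, s.1.1 v = v → α v = 0) ∧
      (∀ x : Module.Dual ℂ V, dualAct s.1.1 x = x → x αv = 0) ∧ α αv = 2 ∧
      l ≠ 1 ∧ dualAct s.1.1 α = l • α := by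
  obtain ⟨w, β, hw, hβ, hs⟩ := reflection_form s
  have hfix : ∀ x : Module.Dual ℂ V, dualAct s.1.1 x = x → x w = 0 := fun x hx => by
    obtain ⟨v, hv⟩ : ∃ v, β v ≠ 0 := by
      by_contra! h
      exact hβ (LinearMap.ext h)
    have h1 := LinearMap.congr_fun hx (s.1.1 v)
    rw [dualAct_apply, reflection_inv', hs, map_add, map_smul, smul_eq_mul] at h1
    have : β v * x w = 0 := by linear_combination -h1
    exact (mul_eq_zero.1 this).resolve_left hv
  have hβw : β w ≠ 0 := by
    intro h0
    have hpow : ∀ (n : ℕ) (v : V), ((s.1.1 ^ n : V ≃ₗ[ℂ] V)) v = v + ((n : ℂ) * β v) • w := by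
      intro n
      induction n with
      | zero => intro v; simp
      | succ n ih =>
        intro v
        rw [pow_succ, LinearEquiv.mul_apply, ih, hs, map_add, map_smul, h0]
        simp only [smul_eq_mul, mul_zero, add_zero, Nat.cast_add, Nat.cast_one, add_mul, one_mul,
          add_smul]
        abel
    obtain ⟨n, hn, hn1⟩ := isOfFinOrder_iff_pow_eq_one.1 (isOfFinOrder_of_finite s.1)
    apply hβ
    ext v
    have h2 := hpow n v
    have h3 : (s.1.1 ^ n : V ≃ₗ[ℂ] V) = 1 := by
      have := congrArg Subtype.val hn1
      simpa using this
    rw [h3] at h2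
    have h4 : ((n : ℂ) * β v) • w = 0 := by simpa using h2
    have h5 := (smul_eq_zero.1 h4).resolve_right hw
    have hn' : (n : ℂ) ≠ 0 := by exact_mod_cast hn.ne'
    simpa [hn'] using h5
  have hμ : 1 + β w ≠ 0 := by
    intro h
    have h1 := hs w
    have h2 : s.1.1 w = 0 := by
      rw [h1]
      have : w + β w • w = (1 + β w) • w := by rw [add_smul, one_smul]
      rw [this, h, zero_smul]
    exact hw (by simpa using h2)
  refine ⟨β, (2 / β w) • w, (1 + β w)⁻¹, hβ, ?_, ?_, ?_, ?_, ?_⟩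
  · intro v hv
    rw [hs] at hv
    have : β v • w = 0 := by simpa using hv
    exact (smul_eq_zero.1 this).resolve_right hw
  · intro x hx
    rw [map_smul, hfix x hx, smul_zero]
  · rw [map_smul, smul_eq_mul]; field_simp
  · intro h
    have : 1 + β w = 1 := by rw [← inv_inv (1 + β w), h, inv_one]
    exact hβw (by linear_combination this)
  · ext v
    have h1 : β (s.1.1 (s.1.1⁻¹ v)) = β (s.1.1⁻¹ v) * (1 + β w) := by
      rw [hs (s.1.1⁻¹ v), map_add, map_smul, smul_eq_mul]; ring
    rw [reflection_inv] at h1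
    rw [dualAct_apply, LinearMap.smul_apply, smul_eq_mul, h1]
    field_simp

/-- `α_s`: a nonzero linear function on `V` vanishing on the fixed hyperplane of `s`. -/
noncomputable def root (s : reflections G) : Module.Dual ℂ V := (exists_root s).choose

/-- `α_s^∨`: the vector on which all `s`-fixed linear functions vanish and with
`(α_s, α_s^∨) = 2`. -/
noncomputable def coroot (s : reflections G) : V := (exists_root s).choose_spec.choose

/-- `λ_s`: the eigenvalue different from `1` of `s` acting on `V*`. -/
noncomputable def eigenvalue (s : reflections G) : ℂ :=
  (exists_root s).choose_spec.choose_spec.choose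

theorem root_spec (s : reflections G) :
    root s ≠ 0 ∧ (∀ v, s.1.1 v = v → root s v = 0) ∧
      (∀ x : Module.Dual ℂ V, dualAct s.1.1 x = x → x (coroot s) = 0) ∧
      root s (coroot s) = 2 ∧ eigenvalue s ≠ 1 ∧
      dualAct s.1.1 (root s) = eigenvalue s • root s :=
  (exists_root s).choose_spec.choose_spec.choose_spec

theorem reflection_apply_inv (s : reflections G) (v : V) :
    s.1.1⁻¹ v = v - ((1 - eigenvalue s) / 2 * root s v) • coroot s := by
  obtain ⟨w, β, hw, hβ, hs⟩ := reflection_form s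
  obtain ⟨hα, hker, hco, h2, hl, hact⟩ := root_spec s
  -- `α = a β`
  obtain ⟨a, ha⟩ : ∃ a : ℂ, ∀ v, root s v = a * β v := by
    obtain ⟨v0, hv0⟩ : ∃ v, β v ≠ 0 := by
      by_contra! h
      exact hβ (LinearMap.ext h)
    refine ⟨root s v0 / β v0, fun v => ?_⟩
    have h := hker (v - (β v / β v0) • v0) (by
      rw [hs]
      have : β (v - (β v / β v0) • v0) = 0 := by
        rw [map_sub, map_smul, smul_eq_mul]; field_simp; ring
      rw [this, zero_smul, add_zero])
    rw [map_sub, map_smul, smul_eq_mul] at h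
    field_simp
    field_simp at h
    linear_combination h
  obtain ⟨e, he⟩ : ∃ e : ℂ, coroot s = e • w := by
    by_contra! hne
    have hnot : coroot s ∉ Submodule.span ℂ {w} := fun hm => by
      obtain ⟨e, he⟩ := Submodule.mem_span_singleton.1 hm
      exact hne e he.symm
    obtain ⟨x, hx, hx0⟩ := Submodule.exists_le_ker_of_notMem hnot
    have hxw : x w = 0 := hx0 (Submodule.mem_span_singleton_self w)
    refine hx (hco x ?_)
    ext v
    have h1 : x (s.1.1 (s.1.1⁻¹ v)) = x (s.1.1⁻¹ v) := by
      rw [hs (s.1.1⁻¹ v), map_add, map_smul, hxw, smul_zero, add_zero]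
    rw [dualAct_apply, ← h1, reflection_inv]
  have hinv : s.1.1⁻¹ v = v - β (s.1.1⁻¹ v) • w := by
    have := hs (s.1.1⁻¹ v)
    rw [reflection_inv] at this
    rw [eq_sub_iff_add_eq]; exact this.symm
  have ha0 : a ≠ 0 := by
    rintro rfl
    apply hα; ext v; simp [ha]
  have hlam : ∀ v, β (s.1.1⁻¹ v) = eigenvalue s * β v := fun v => by
    have := LinearMap.congr_fun hact v
    rw [dualAct_apply, LinearMap.smul_apply, smul_eq_mul, ha, ha] at this
    exact mul_left_cancel₀ ha0 (by linear_combination this)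
  have hβw : eigenvalue s * β w = 1 - eigenvalue s := by
    obtain ⟨v0, hv0⟩ : ∃ v, β v ≠ 0 := by
      by_contra! h
      exact hβ (LinearMap.ext h)
    have h3 : β v0 = β (s.1.1⁻¹ v0) * (1 + β w) := by
      conv_lhs => rw [← reflection_inv s.1.1 v0, hs (s.1.1⁻¹ v0), map_add, map_smul, smul_eq_mul]
      ring
    rw [hlam] at h3
    exact mul_left_cancel₀ hv0 (by linear_combination -h3)
  have hae : a * e * β w = 2 := by
    rw [he, map_smul, ha, smul_eq_mul] at h2
    linear_combination h2
  rw [hinv, hlam, he, smul_smul, ha, ← hβw]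
  congr 2
  linear_combination (-(eigenvalue s * β v) / 2) * hae

theorem dualAct_reflection (s : reflections G) (x : Module.Dual ℂ V) :
    dualAct s.1.1 x = x - ((1 - eigenvalue s) / 2 * x (coroot s)) • root s := by
  ext v
  rw [dualAct_apply, reflection_apply_inv, map_sub, map_smul]
  simp only [LinearMap.sub_apply, LinearMap.smul_apply, smul_eq_mul]
  ring

theorem eigenvalue_unique (s : reflections G) (x : Module.Dual ℂ V) (l : ℂ) (hx : x ≠ 0)
    (hl : l ≠ 1) (h : dualAct s.1.1 x = l • x) : l = eigenvalue s := by
  obtain ⟨hα, -, -, -, -, hact⟩ := root_spec s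
  rw [dualAct_reflection] at h
  set d := (1 - eigenvalue s) / 2 * x (coroot s) with hd
  have hl' : 1 - l ≠ 0 := sub_ne_zero.2 (Ne.symm hl)
  have hx' : x = ((1 - l)⁻¹ * d) • root s := by
    have : (1 - l) • x = d • root s := by
      rw [sub_smul, one_smul, ← h]; abel
    rw [mul_smul, ← this, smul_smul, inv_mul_cancel₀ hl', one_smul]
  set q := (1 - l)⁻¹ * d
  have hq : q ≠ 0 := by
    intro h0; rw [h0, zero_smul] at hx'; exact hx hx'
  have h2 : dualAct s.1.1 x = eigenvalue s • x := by
    rw [hx', map_smul, hact, smul_comm]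
  rw [dualAct_reflection, ← hd, h, ← sub_eq_zero, ← sub_smul] at h2
  exact sub_eq_zero.1 ((smul_eq_zero.1 h2).resolve_right hx)

end Reflections

section Algebra

variable {V : Type u} [AddCommGroup V] [Module ℂ V] {G : Subgroup (V ≃ₗ[ℂ] V)}

noncomputable instance [Finite G] : Fintype (reflections G) := Fintype.ofFinite _

variable (G) in
/-- The generators of the rational Cherednik algebra: the elements of `G`, `V` and `V*`. -/
inductive Gen : Type u
  | ofG (g : G)
  | ofV (y : V)
  | ofDual (x : Module.Dual ℂ V)

open Gen FreeAlgebra in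
/-- The defining relations of the rational Cherednik algebra `H_{t,c}(V, G)`. The first six say
that the generators form a copy of the group `G` and of the vector spaces `V` and `V*`. -/
inductive Rel [Finite G] (t : ℂ) (c : Parameter G) :
    FreeAlgebra ℂ (Gen G) → FreeAlgebra ℂ (Gen G) → Prop
  | g_one : Rel t c (ι ℂ (ofG 1)) 1
  | g_mul (g g' : G) : Rel t c (ι ℂ (ofG (g * g'))) (ι ℂ (ofG g) * ι ℂ (ofG g'))
  | y_add (y y' : V) : Rel t c (ι ℂ (ofV (y + y'))) (ι ℂ (ofV y) + ι ℂ (ofV y'))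
  | y_smul (r : ℂ) (y : V) : Rel t c (ι ℂ (ofV (r • y))) (r • ι ℂ (ofV y))
  | x_add (x x' : Module.Dual ℂ V) :
      Rel t c (ι ℂ (ofDual (x + x'))) (ι ℂ (ofDual x) + ι ℂ (ofDual x'))
  | x_smul (r : ℂ) (x : Module.Dual ℂ V) : Rel t c (ι ℂ (ofDual (r • x))) (r • ι ℂ (ofDual x))
  | conj_x (g : G) (x : Module.Dual ℂ V) :
      Rel t c (ι ℂ (ofG g) * ι ℂ (ofDual x) * ι ℂ (ofG g⁻¹)) (ι ℂ (ofDual (dualAct g.1 x)))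
  | conj_y (g : G) (y : V) :
      Rel t c (ι ℂ (ofG g) * ι ℂ (ofV y) * ι ℂ (ofG g⁻¹)) (ι ℂ (ofV (g.1 y)))
  | comm_x (x x' : Module.Dual ℂ V) :
      Rel t c (ι ℂ (ofDual x) * ι ℂ (ofDual x')) (ι ℂ (ofDual x') * ι ℂ (ofDual x))
  | comm_y (y y' : V) : Rel t c (ι ℂ (ofV y) * ι ℂ (ofV y')) (ι ℂ (ofV y') * ι ℂ (ofV y))
  | main (y : V) (x : Module.Dual ℂ V) :
      Rel t c (ι ℂ (ofV y) * ι ℂ (ofDual x) - ι ℂ (ofDual x) * ι ℂ (ofV y))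
        (algebraMap ℂ _ (t * x y) -
          ∑ s : reflections G, (c.toFun s * root s y * x (coroot s)) • ι ℂ (ofG s.1))

variable [Finite G]

/-- The rational Cherednik algebra `H_{t,c}(V, G)`. -/
def H (t : ℂ) (c : Parameter G) : Type u := RingQuot (Rel t c)

variable (t : ℂ) (c : Parameter G)

noncomputable instance : Ring (H t c) := inferInstanceAs (Ring (RingQuot (Rel t c)))

noncomputable instance : Algebra ℂ (H t c) := inferInstanceAs (Algebra ℂ (RingQuot (Rel t c)))

/-- The image in `H_{t,c}(V, G)` of a generator. -/
noncomputable def gen (a : Gen G) : H t c :=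
  RingQuot.mkAlgHom ℂ (Rel t c) (FreeAlgebra.ι ℂ a)

theorem rel_eq {a b : FreeAlgebra ℂ (Gen G)} (h : Rel t c a b) :
    (RingQuot.mkAlgHom ℂ (Rel t c) a : H t c) = RingQuot.mkAlgHom ℂ (Rel t c) b :=
  RingQuot.mkAlgHom_rel ℂ h

/-- The group `G` inside `H_{t,c}(V, G)`. -/
noncomputable def gHom : G →* H t c where
  toFun g := gen t c (.ofG g)
  map_one' := (rel_eq t c Rel.g_one).trans (map_one (RingQuot.mkAlgHom ℂ (Rel t c)))
  map_mul' g g' := (rel_eq t c (Rel.g_mul g g')).trans (map_mul (RingQuot.mkAlgHom ℂ (Rel t c)) _ _)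

/-- The space `V` inside `H_{t,c}(V, G)`. -/
noncomputable def yHom : V →ₗ[ℂ] H t c where
  toFun y := gen t c (.ofV y)
  map_add' y y' := (rel_eq t c (Rel.y_add y y')).trans (map_add (RingQuot.mkAlgHom ℂ (Rel t c)) _ _)
  map_smul' r y := (rel_eq t c (Rel.y_smul r y)).trans
    (map_smul (RingQuot.mkAlgHom ℂ (Rel t c)) r _)

/-- The space `V*` inside `H_{t,c}(V, G)`. -/
noncomputable def xHom : Module.Dual ℂ V →ₗ[ℂ] H t c where
  toFun x := gen t c (.ofDual x)
  map_add' x x' := (rel_eq t c (Rel.x_add x x')).trans (map_add (RingQuot.mkAlgHom ℂ (Rel t c)) _ _)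
  map_smul' r x := (rel_eq t c (Rel.x_smul r x)).trans
    (map_smul (RingQuot.mkAlgHom ℂ (Rel t c)) r _)

theorem g_x (g : G) (x : Module.Dual ℂ V) :
    gHom t c g * xHom t c x = xHom t c (dualAct g.1 x) * gHom t c g := by
  have h : gHom t c g * xHom t c x * gHom t c g⁻¹ = xHom t c (dualAct g.1 x) := by
    have := rel_eq t c (Rel.conj_x g x)
    rwa [map_mul, map_mul] at this
  rw [← h, mul_assoc, mul_assoc, ← map_mul, inv_mul_cancel, map_one, mul_one]

theorem g_y (g : G) (y : V) :
    gHom t c g * yHom t c y = yHom t c (g.1 y) * gHom t c g := by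
  have h : gHom t c g * yHom t c y * gHom t c g⁻¹ = yHom t c (g.1 y) := by
    have := rel_eq t c (Rel.conj_y g y)
    rwa [map_mul, map_mul] at this
  rw [← h, mul_assoc, mul_assoc, ← map_mul, inv_mul_cancel, map_one, mul_one]

theorem x_x (x x' : Module.Dual ℂ V) : xHom t c x * xHom t c x' = xHom t c x' * xHom t c x := by
  have := rel_eq t c (Rel.comm_x x x')
  rwa [map_mul, map_mul] at this

theorem y_y (y y' : V) : yHom t c y * yHom t c y' = yHom t c y' * yHom t c y := by
  have := rel_eq t c (Rel.comm_y y y')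
  rwa [map_mul, map_mul] at this

theorem y_x (y : V) (x : Module.Dual ℂ V) :
    yHom t c y * xHom t c x = xHom t c x * yHom t c y + (t * x y) • 1 -
      ∑ s : reflections G, (c.toFun s * root s y * x (coroot s)) • gHom t c s.1 := by
  have h := rel_eq t c (Rel.main y x)
  rw [map_sub, map_sub, map_mul, map_mul, map_sum, AlgHom.commutes,
    Algebra.algebraMap_eq_smul_one] at h
  simp only [map_smul] at h
  have h' : yHom t c y * xHom t c x - xHom t c x * yHom t c y = (t * x y) • 1 -
      ∑ s : reflections G, (c.toFun s * root s y * x (coroot s)) • gHom t c s.1 := h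
  rw [add_sub_assoc, ← h']; abel

/-! ### The Euler element -/

variable {ι : Type*} [Fintype ι] (b : Module.Basis ι ℂ V)

/-- The Euler element `∑ x_i y_i + ℓ t / 2 - ∑_s 2 c_s / (1 - λ_s) s`. -/
noncomputable def euler : H t c :=
  ∑ i, xHom t c (b.coord i) * yHom t c (b i) +
    algebraMap ℂ _ ((Module.finrank ℂ V : ℂ) * t / 2) -
    ∑ s : reflections G, (2 * c.toFun s / (1 - eigenvalue s)) • gHom t c s.1

theorem sum_coord_y (y : V) (x : Module.Dual ℂ V) : ∑ i, b.coord i y * x (b i) = x y := by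
  conv_rhs => rw [← b.sum_repr y, map_sum]
  simp

theorem euler_x (x : Module.Dual ℂ V) :
    euler t c b * xHom t c x = xHom t c x * euler t c b + t • xHom t c x := by
  have h1 : ∑ i, xHom t c (b.coord i) * yHom t c (b i) * xHom t c x =
      xHom t c x * ∑ i, xHom t c (b.coord i) * yHom t c (b i) + t • xHom t c x -
        ∑ s : reflections G, (c.toFun s * x (coroot s)) • (xHom t c (root s) * gHom t c s.1) := by
    have e1 : ∀ y' : Module.Dual ℂ V, xHom t c y' = ∑ i, (y' (b i)) • xHom t c (b.coord i) := by
      intro y'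
      rw [← Module.Basis.sum_dual_apply_smul_coord b y', map_sum]
      simp only [map_smul, Module.Basis.sum_dual_apply_smul_coord]
    have e2 : ∀ i, xHom t c (b.coord i) * yHom t c (b i) * xHom t c x =
        xHom t c x * (xHom t c (b.coord i) * yHom t c (b i)) +
          t • (x (b i) • xHom t c (b.coord i)) -
          ∑ s : reflections G, (c.toFun s * x (coroot s)) •
            ((root s (b i) • xHom t c (b.coord i)) * gHom t c s.1) := by
      intro i
      rw [mul_assoc, y_x, mul_sub, mul_add, ← mul_assoc, x_x t c (b.coord i) x, mul_assoc,
        Finset.mul_sum]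
      congr 2
      · simp [mul_smul]
      · funext s
        rw [mul_smul_comm, smul_mul_assoc, smul_smul]; congr 1; ring
    rw [Finset.sum_congr rfl fun i _ => e2 i, Finset.sum_sub_distrib, Finset.sum_add_distrib,
      ← Finset.mul_sum, ← Finset.smul_sum, ← e1, Finset.sum_comm]
    congr 2
    funext s
    rw [← Finset.smul_sum, ← Finset.sum_mul, ← e1]
  have h2 : ∀ s : reflections G, (2 * c.toFun s / (1 - eigenvalue s)) • gHom t c s.1 * xHom t c x =
      xHom t c x * ((2 * c.toFun s / (1 - eigenvalue s)) • gHom t c s.1) -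
        (c.toFun s * x (coroot s)) • (xHom t c (root s) * gHom t c s.1) := by
    intro s
    have hne : 1 - eigenvalue s ≠ 0 := sub_ne_zero.2 (Ne.symm (root_spec s).2.2.2.2.1)
    rw [smul_mul_assoc, g_x, dualAct_reflection, map_sub, map_smul, sub_mul, smul_sub,
      mul_smul_comm, smul_mul_assoc, smul_smul]
    congr 2
    field_simp
  rw [euler, sub_mul, add_mul, Finset.sum_mul, Finset.sum_mul, h1,
    Finset.sum_congr rfl fun s _ => h2 s, Finset.sum_sub_distrib, mul_sub, mul_add,
    Finset.mul_sum Finset.univ (fun s : reflections G => _ • gHom t c s.1),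
    Algebra.commutes]
  abel

theorem euler_y (y : V) :
    euler t c b * yHom t c y = yHom t c y * euler t c b - t • yHom t c y := by
  have h1 : yHom t c y * ∑ i, xHom t c (b.coord i) * yHom t c (b i) =
      (∑ i, xHom t c (b.coord i) * yHom t c (b i)) * yHom t c y + t • yHom t c y -
        ∑ s : reflections G, (c.toFun s * root s y) • (gHom t c s.1 * yHom t c (coroot s)) := by
    have e1 : ∀ y' : V, yHom t c y' = ∑ i, (b.coord i y') • yHom t c (b i) := by
      intro y'
      conv_lhs => rw [← b.sum_repr y', map_sum]
      simp
    have e2 : ∀ i, yHom t c y * (xHom t c (b.coord i) * yHom t c (b i)) =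
        xHom t c (b.coord i) * yHom t c (b i) * yHom t c y +
          t • (b.coord i y • yHom t c (b i)) -
          ∑ s : reflections G, (c.toFun s * root s y) •
            (gHom t c s.1 * (b.coord i (coroot s) • yHom t c (b i))) := by
      intro i
      rw [← mul_assoc, y_x, sub_mul, add_mul, mul_assoc, y_y t c y (b i), ← mul_assoc,
        Finset.sum_mul]
      congr 2
      · simp [mul_smul]
      · funext s
        rw [mul_smul_comm, smul_mul_assoc, smul_smul]
    rw [Finset.mul_sum, Finset.sum_congr rfl fun i _ => e2 i, Finset.sum_sub_distrib,
      Finset.sum_add_distrib, ← Finset.sum_mul, ← Finset.smul_sum, ← e1, Finset.sum_comm]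
    congr 2
    funext s
    rw [← Finset.smul_sum, ← Finset.mul_sum, ← e1]
  have h2 : ∀ s : reflections G, yHom t c y * ((2 * c.toFun s / (1 - eigenvalue s)) • gHom t c s.1) =
      (2 * c.toFun s / (1 - eigenvalue s)) • gHom t c s.1 * yHom t c y -
        (c.toFun s * root s y) • (gHom t c s.1 * yHom t c (coroot s)) := by
    intro s
    have hne : 1 - eigenvalue s ≠ 0 := sub_ne_zero.2 (Ne.symm (root_spec s).2.2.2.2.1)
    have h3 : yHom t c y * gHom t c s.1 = gHom t c s.1 * yHom t c (s.1.1⁻¹ y) := by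
      rw [g_y, reflection_inv]
    rw [mul_smul_comm, h3, reflection_apply_inv, map_sub, map_smul, mul_sub, smul_sub,
      mul_smul_comm, smul_mul_assoc, smul_smul]
    congr 2
    field_simp
  rw [euler, mul_sub, mul_add, h1, Finset.mul_sum,
    Finset.sum_congr rfl fun s _ => h2 s, Finset.sum_sub_distrib, sub_mul, add_mul,
    Finset.sum_mul Finset.univ (fun s : reflections G => _ • gHom t c s.1),
    ← Algebra.commutes]
  abel

theorem eigenvalue_conj (g : G) (s : reflections G) :
    eigenvalue (⟨g * s.1 * g⁻¹, conj_mem g s⟩ : reflections G) = eigenvalue s := by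
  obtain ⟨hα, -, -, -, hl, hact⟩ := root_spec s
  symm
  apply eigenvalue_unique _ (dualAct g.1 (root s)) _ _ hl
  · ext v
    have := LinearMap.congr_fun hact (g.1⁻¹ v)
    simpa [dualAct, mul_assoc] using this
  · intro h
    apply hα
    ext v
    have := LinearMap.congr_fun h (g.1 v)
    simpa [dualAct] using this

theorem euler_g (g : G) : euler t c b * gHom t c g = gHom t c g * euler t c b := by
  have h1 : gHom t c g * ∑ i, xHom t c (b.coord i) * yHom t c (b i) =
      (∑ i, xHom t c (b.coord i) * yHom t c (b i)) * gHom t c g := by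
    have e1 : ∀ y' : V, yHom t c y' = ∑ i, (b.coord i y') • yHom t c (b i) := by
      intro y'
      conv_lhs => rw [← b.sum_repr y', map_sum]
      simp
    have e2 : ∀ j, xHom t c (b.coord j) =
        ∑ i, (b.coord j (g.1 (b i))) • xHom t c (dualAct g.1 (b.coord i)) := by
      intro j
      simp only [← map_smul, ← map_sum]
      congr 1
      ext v
      simp only [LinearMap.sum_apply, LinearMap.smul_apply, dualAct_apply, smul_eq_mul]
      have := sum_coord_y b (g.1⁻¹ v) ((b.coord j).comp g.1.toLinearMap)
      simp only [LinearMap.comp_apply, LinearEquiv.coe_coe, reflection_inv] at this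
      rw [← this]
      exact Finset.sum_congr rfl fun i _ => mul_comm _ _
    have e3 : ∀ i, gHom t c g * (xHom t c (b.coord i) * yHom t c (b i)) =
        ∑ j, (b.coord j (g.1 (b i)) • xHom t c (dualAct g.1 (b.coord i))) * yHom t c (b j) *
          gHom t c g := by
      intro i
      rw [← mul_assoc, g_x, mul_assoc, g_y, ← mul_assoc, e1 (g.1 (b i)), Finset.mul_sum,
        Finset.sum_mul]
      refine Finset.sum_congr rfl fun j _ => ?_
      rw [mul_smul_comm, smul_mul_assoc, smul_mul_assoc, smul_mul_assoc]
    rw [Finset.mul_sum, Finset.sum_congr rfl fun i _ => e3 i, Finset.sum_comm, Finset.sum_mul]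
    refine Finset.sum_congr rfl fun j _ => ?_
    rw [← Finset.sum_mul, ← Finset.sum_mul, ← e2]
  have h2 : gHom t c g * ∑ s : reflections G, (2 * c.toFun s / (1 - eigenvalue s)) • gHom t c s.1 =
      (∑ s : reflections G, (2 * c.toFun s / (1 - eigenvalue s)) • gHom t c s.1) * gHom t c g := by
    rw [Finset.mul_sum, Finset.sum_mul]
    refine Fintype.sum_equiv
      { toFun := fun s => ⟨g * s.1 * g⁻¹, conj_mem g s⟩
        invFun := fun s => ⟨g⁻¹ * s.1 * g⁻¹⁻¹, conj_mem g⁻¹ s⟩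
        left_inv := fun s => Subtype.ext (by simp [mul_assoc])
        right_inv := fun s => Subtype.ext (by simp [mul_assoc]) } _ _ fun s => ?_
    have hc : c.toFun ⟨g * s.1 * g⁻¹, conj_mem g s⟩ = c.toFun s :=
      (c.invariant _ _ (isConj_iff.2 ⟨g, rfl⟩)).symm
    simp only [Equiv.coe_fn_mk, eigenvalue_conj, hc, mul_smul_comm, smul_mul_assoc, ← map_mul]
    congr 2
    group
  rw [euler, mul_sub, mul_add, h1, h2, sub_mul, add_mul, Algebra.commutes]

end Algebra

section Completion

variable {V : Type u} [AddCommGroup V] [Module ℂ V] {G : Subgroup (V ≃ₗ[ℂ] V)} [Finite G]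
  (t : ℂ) (c : Parameter G)

/-- The subspace `V*` of `H_{t,c}`. -/
noncomputable def X : Submodule ℂ (H t c) := LinearMap.range (xHom t c)

/-- The subspace `V` of `H_{t,c}`. -/
noncomputable def Y : Submodule ℂ (H t c) := LinearMap.range (yHom t c)

/-- The subalgebra generated by `G` and `V*`, as a subspace. -/
noncomputable def B : Submodule ℂ (H t c) :=
  Subalgebra.toSubmodule <| Algebra.adjoin ℂ (Set.range (gHom t c) ∪ Set.range (xHom t c))

/-- The filtration `F^n` with `deg G = deg V* = 0`, `deg V = 1`: the span of all products of
generators with at most `n` factors from `V`. -/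
noncomputable def F (n : ℕ) : Submodule ℂ (H t c) :=
  (B t c * (1 ⊔ Y t c)) ^ n * B t c

/-- `I^k F^n`, where `I` is the ideal of the origin in `ℂ[V]`. (As `F^n` is a left module over
`ℂ[V]` and `I = V* ℂ[V]`, this is the span of all `x_1 ⋯ x_k a` with `x_i ∈ V*` and `a ∈ F^n`.) -/
noncomputable def IF (k n : ℕ) : Submodule ℂ (H t c) := X t c ^ k * F t c n

theorem BB : B t c * B t c = B t c := (Subalgebra.isIdempotentElem_toSubmodule _).eq

theorem one_le_B : 1 ≤ B t c := Submodule.one_le.2 (one_mem (Algebra.adjoin ℂ _))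

theorem X_le_B : X t c ≤ B t c := by
  rintro _ ⟨x, rfl⟩
  exact Algebra.subset_adjoin (Or.inr ⟨x, rfl⟩)

theorem B_F (n : ℕ) : B t c * F t c n = F t c n := by
  cases n with
  | zero => simp [F, BB]
  | succ n => rw [F, pow_succ']; simp only [← mul_assoc, BB]

theorem F_mul (m n : ℕ) : F t c m * F t c n = F t c (m + n) := by
  have h : F t c m * F t c n = (B t c * (1 ⊔ Y t c)) ^ m * (B t c * F t c n) := by
    rw [← mul_assoc]; rfl
  rw [h, B_F, F, F, ← mul_assoc, ← pow_add]

theorem one_mem_F (n : ℕ) : (1 : Submodule ℂ (H t c)) ≤ F t c n := by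
  have h1 : (1 : Submodule ℂ (H t c)) ≤ B t c * (1 ⊔ Y t c) := by
    calc (1 : Submodule ℂ (H t c)) = 1 * 1 := (one_mul 1).symm
      _ ≤ _ := mul_le_mul' (one_le_B t c) le_sup_left
  calc (1 : Submodule ℂ (H t c)) = 1 ^ n * 1 := by simp
      _ ≤ _ := mul_le_mul' (pow_le_pow_left' h1 n) (one_le_B t c)

theorem F_mono {m n : ℕ} (h : m ≤ n) : F t c m ≤ F t c n := by
  obtain ⟨d, rfl⟩ := Nat.exists_eq_add_of_le h
  rw [← F_mul]
  calc F t c m = F t c m * 1 := (mul_one _).symm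
    _ ≤ _ := mul_le_mul' le_rfl (one_mem_F t c d)

theorem IF_mono {k m n : ℕ} (h : m ≤ n) : IF t c k m ≤ IF t c k n :=
  mul_le_mul' le_rfl (F_mono t c h)

theorem X_F (n : ℕ) : X t c * F t c n ≤ F t c n := by
  conv_rhs => rw [← B_F]
  exact mul_le_mul' (X_le_B t c) le_rfl

theorem IF_succ (k n : ℕ) : IF t c (k + 1) n ≤ IF t c k n := by
  rw [IF, IF, pow_succ, mul_assoc]
  exact mul_le_mul' le_rfl (X_F t c n)

theorem IF_anti {k l n : ℕ} (h : k ≤ l) : IF t c l n ≤ IF t c k n := by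
  induction l, h using Nat.le_induction with
  | base => exact le_rfl
  | succ l _ ih => exact (IF_succ t c l n).trans ih

theorem IF_le (k n : ℕ) : IF t c k n ≤ F t c n := by
  have := IF_anti t c (Nat.zero_le k) (n := n)
  rwa [IF, IF, pow_zero, one_mul] at this

theorem IF_mul_F (k m n : ℕ) : IF t c k m * F t c n = IF t c k (m + n) := by
  rw [IF, IF, mul_assoc, F_mul]

theorem B_X : B t c * X t c ≤ X t c * B t c := by
  rw [Submodule.mul_le]
  intro a ha0 x hx
  have ha' : a ∈ Algebra.adjoin ℂ (Set.range (gHom t c) ∪ Set.range (xHom t c)) := ha0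
  clear ha0
  induction ha' using Algebra.adjoin_induction generalizing x with
  | mem a h =>
    obtain ⟨x', rfl⟩ := hx
    rcases h with ⟨g, rfl⟩ | ⟨x, rfl⟩
    · rw [g_x]
      exact Submodule.mul_mem_mul ⟨_, rfl⟩ (Algebra.subset_adjoin (Or.inl ⟨g, rfl⟩))
    · exact Submodule.mul_mem_mul ⟨_, rfl⟩ (Algebra.subset_adjoin (Or.inr ⟨_, rfl⟩))
  | algebraMap r =>
    rw [Algebra.commutes]
    exact Submodule.mul_mem_mul hx (Subalgebra.algebraMap_mem (Algebra.adjoin ℂ _) _)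
  | add a b ha hb iha ihb =>
    rw [add_mul]
    exact Submodule.add_mem _ (iha x hx) (ihb x hx)
  | mul a b ha hb iha ihb =>
    have h1 : ∀ z ∈ X t c * B t c, a * z ∈ X t c * B t c := by
      intro z hz
      induction hz using Submodule.mul_induction_on' with
      | mem_mul_mem p hp q hq =>
        rw [← mul_assoc]
        have := Submodule.mul_mem_mul (iha p hp) hq
        rwa [mul_assoc, BB] at this
      | add p _ q _ hp hq => rw [mul_add]; exact Submodule.add_mem _ hp hq
    rw [mul_assoc]
    exact h1 _ (ihb x hx)

theorem B_Xpow (k : ℕ) : B t c * X t c ^ k ≤ X t c ^ k * B t c := by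
  induction k with
  | zero => simp
  | succ k ih =>
    calc B t c * X t c ^ (k + 1) = B t c * X t c ^ k * X t c := by rw [pow_succ, mul_assoc]
      _ ≤ X t c ^ k * B t c * X t c := mul_le_mul' ih le_rfl
      _ = X t c ^ k * (B t c * X t c) := mul_assoc _ _ _
      _ ≤ X t c ^ k * (X t c * B t c) := mul_le_mul' le_rfl (B_X t c)
      _ = _ := by rw [pow_succ, mul_assoc]

theorem B_IF (k n : ℕ) : B t c * IF t c k n ≤ IF t c k n := by
  calc B t c * IF t c k n = B t c * X t c ^ k * F t c n := (mul_assoc _ _ _).symm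
    _ ≤ X t c ^ k * B t c * F t c n := mul_le_mul' (B_Xpow t c k) le_rfl
    _ = _ := by rw [mul_assoc, B_F, IF]

theorem Y_X : Y t c * X t c ≤ X t c * Y t c ⊔ B t c := by
  rw [Submodule.mul_le]
  rintro _ ⟨y, rfl⟩ _ ⟨x, rfl⟩
  rw [y_x, add_sub_assoc]
  refine Submodule.add_mem_sup (Submodule.mul_mem_mul ⟨_, rfl⟩ ⟨_, rfl⟩) ?_
  refine Submodule.sub_mem _ (Submodule.smul_mem _ _ (Submodule.one_le.1 (one_le_B t c)))
    (Submodule.sum_mem _ fun s _ => Submodule.smul_mem _ _ ?_)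
  exact Algebra.subset_adjoin (Or.inl ⟨_, rfl⟩)

theorem Y_Xpow (k : ℕ) :
    Y t c * X t c ^ (k + 1) ≤ X t c ^ (k + 1) * Y t c ⊔ X t c ^ k * B t c := by
  induction k with
  | zero => simpa using Y_X t c
  | succ k ih =>
    calc Y t c * X t c ^ (k + 1 + 1) = Y t c * X t c ^ (k + 1) * X t c := by
          rw [pow_succ, mul_assoc]
      _ ≤ (X t c ^ (k + 1) * Y t c ⊔ X t c ^ k * B t c) * X t c := mul_le_mul' ih le_rfl
      _ = X t c ^ (k + 1) * (Y t c * X t c) ⊔ X t c ^ k * (B t c * X t c) := by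
          rw [Submodule.sup_mul, mul_assoc, mul_assoc]
      _ ≤ X t c ^ (k + 1) * (X t c * Y t c ⊔ B t c) ⊔ X t c ^ k * (X t c * B t c) :=
          sup_le_sup (mul_le_mul' le_rfl (Y_X t c))
            (mul_le_mul' le_rfl (B_X t c))
      _ = _ := by
          rw [Submodule.mul_sup, ← mul_assoc, ← mul_assoc, ← pow_succ, ← pow_succ, sup_assoc,
            sup_idem]

theorem Y_le_F : Y t c ≤ F t c 1 := by
  rw [F, pow_one]
  calc Y t c = 1 * Y t c * 1 := by simp
    _ ≤ _ := mul_le_mul' (mul_le_mul' (one_le_B t c) le_sup_right) (one_le_B t c)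

theorem F_one_IF (k n : ℕ) : F t c 1 * IF t c (k + 1) n ≤ IF t c k (1 + n) := by
  have h1 : (1 ⊔ Y t c) * IF t c (k + 1) n ≤ IF t c k (1 + n) := by
    rw [Submodule.sup_mul, one_mul]
    refine sup_le ((IF_succ t c k n).trans (IF_mono t c (by omega))) ?_
    calc Y t c * IF t c (k + 1) n = Y t c * X t c ^ (k + 1) * F t c n := (mul_assoc _ _ _).symm
      _ ≤ (X t c ^ (k + 1) * Y t c ⊔ X t c ^ k * B t c) * F t c n :=
          mul_le_mul' (Y_Xpow t c k) le_rfl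
      _ = X t c ^ (k + 1) * (Y t c * F t c n) ⊔ IF t c k n := by
          rw [Submodule.sup_mul, mul_assoc, mul_assoc, B_F, ← IF]
      _ ≤ IF t c (k + 1) (1 + n) ⊔ IF t c k (1 + n) := by
          refine sup_le_sup (mul_le_mul' le_rfl ?_) (IF_mono t c (by omega))
          rw [← F_mul]
          exact mul_le_mul' (Y_le_F t c) le_rfl
      _ ≤ _ := sup_le (IF_succ t c k _) le_rfl
  calc F t c 1 * IF t c (k + 1) n = B t c * ((1 ⊔ Y t c) * (B t c * IF t c (k + 1) n)) := by
        rw [F, pow_one, mul_assoc, mul_assoc]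
    _ ≤ B t c * ((1 ⊔ Y t c) * IF t c (k + 1) n) :=
        mul_le_mul' le_rfl (mul_le_mul' le_rfl (B_IF t c _ _))
    _ ≤ B t c * IF t c k (1 + n) := mul_le_mul' le_rfl h1
    _ ≤ _ := B_IF t c _ _

theorem F_IF (m k n : ℕ) : F t c m * IF t c (k + m) n ≤ IF t c k (m + n) := by
  induction m generalizing n with
  | zero =>
    have : F t c 0 = B t c := by simp [F]
    rw [this, zero_add]
    exact B_IF t c _ _
  | succ m ih =>
    calc F t c (m + 1) * IF t c (k + (m + 1)) n
        = F t c m * (F t c 1 * IF t c (k + m + 1) n) := by rw [← F_mul, mul_assoc, add_assoc]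
      _ ≤ F t c m * IF t c (k + m) (1 + n) := mul_le_mul' le_rfl (F_one_IF t c _ _)
      _ ≤ IF t c k (m + (1 + n)) := ih _
      _ = _ := by rw [add_assoc]

/-! ### The completed algebra -/

/-- Sequences in some `F^n` that are Cauchy for the `I`-adic topology of `F^n`. -/
noncomputable def cauchySeq : Subalgebra ℂ (ℕ → H t c) where
  carrier := {a | ∃ n, (∀ i, a i ∈ F t c n) ∧
    ∀ k, ∃ N, ∀ i ≥ N, ∀ j ≥ N, a i - a j ∈ IF t c k n}
  mul_mem' := by
    rintro a b ⟨m, ha, ha'⟩ ⟨n, hb, hb'⟩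
    refine ⟨m + n, fun i => ?_, fun k => ?_⟩
    · rw [← F_mul]; exact Submodule.mul_mem_mul (ha i) (hb i)
    obtain ⟨N, hN⟩ := ha' k
    obtain ⟨N', hN'⟩ := hb' (k + m)
    refine ⟨max N N', fun i hi j hj => ?_⟩
    have h : (a * b) i - (a * b) j = (a i - a j) * b i + a j * (b i - b j) := by
      simp only [Pi.mul_apply]; noncomm_ring
    rw [h]
    refine Submodule.add_mem _ ?_ ?_
    · rw [← IF_mul_F]
      exact Submodule.mul_mem_mul (hN i (le_of_max_le_left hi) j (le_of_max_le_left hj)) (hb i)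
    · exact F_IF t c m k n (Submodule.mul_mem_mul (ha j)
        (hN' i (le_of_max_le_right hi) j (le_of_max_le_right hj)))
  add_mem' := by
    rintro a b ⟨m, ha, ha'⟩ ⟨n, hb, hb'⟩
    refine ⟨max m n, fun i => Submodule.add_mem _ (F_mono t c (le_max_left _ _) (ha i))
      (F_mono t c (le_max_right _ _) (hb i)), fun k => ?_⟩
    obtain ⟨N, hN⟩ := ha' k
    obtain ⟨N', hN'⟩ := hb' k
    refine ⟨max N N', fun i hi j hj => ?_⟩
    rw [Pi.add_apply, Pi.add_apply, add_sub_add_comm]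
    exact Submodule.add_mem _
      (IF_mono t c (le_max_left _ _) (hN i (le_of_max_le_left hi) j (le_of_max_le_left hj)))
      (IF_mono t c (le_max_right _ _) (hN' i (le_of_max_le_right hi) j (le_of_max_le_right hj)))
  algebraMap_mem' r := by
    refine ⟨0, fun i => ?_, fun k => ⟨0, fun i _ j _ => by simp⟩⟩
    have : algebraMap ℂ (H t c) r ∈ (1 : Submodule ℂ (H t c)) := Submodule.mem_one.2 ⟨r, rfl⟩
    exact one_mem_F t c 0 this

noncomputable instance : Ring (cauchySeq t c) := Subalgebra.toRing _

/-- Null sequences: those that tend to `0` in the `I`-adic topology of some `F^n`. -/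
noncomputable def nullSeq : Ideal (cauchySeq t c) where
  carrier := {a | ∃ n, ∀ k, ∃ N, ∀ i ≥ N, a.1 i ∈ IF t c k n}
  add_mem' := by
    rintro a b ⟨m, ha⟩ ⟨n, hb⟩
    refine ⟨max m n, fun k => ?_⟩
    obtain ⟨N, hN⟩ := ha k
    obtain ⟨N', hN'⟩ := hb k
    exact ⟨max N N', fun i hi => Submodule.add_mem _
      (IF_mono t c (le_max_left _ _) (hN i (le_of_max_le_left hi)))
      (IF_mono t c (le_max_right _ _) (hN' i (le_of_max_le_right hi)))⟩
  zero_mem' := ⟨0, fun k => ⟨0, fun i _ => Submodule.zero_mem _⟩⟩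
  smul_mem' := by
    rintro ⟨a, m, ha, -⟩ b ⟨n, hb⟩
    refine ⟨m + n, fun k => ?_⟩
    obtain ⟨N, hN⟩ := hb (k + m)
    exact ⟨N, fun i hi => F_IF t c m k n (Submodule.mul_mem_mul (ha i) (hN i hi))⟩

instance : (nullSeq t c).IsTwoSided where
  mul_mem_of_left := by
    rintro a ⟨b, n, hb, -⟩ ⟨m, ha⟩
    refine ⟨m + n, fun k => ?_⟩
    obtain ⟨N, hN⟩ := ha k
    refine ⟨N, fun i hi => ?_⟩
    rw [← IF_mul_F]
    exact Submodule.mul_mem_mul (hN i hi) (hb i)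

/-- The completed rational Cherednik algebra `H̃_{t,c}(V, G)`, the restriction of `H_{t,c}(V, G)` to
the formal neighbourhood of `0` in `V`. It is the union of the subspaces `F^n H̃`, where `F^n H̃` is
the `I`-adic completion of the `ℂ[V]`-module `F^n H`, with the multiplication extended by
continuity. Since `F^n H` is a finitely generated module over the Noetherian ring `ℂ[V]`, this
completion is `ℂ[[V]] ⊗_{ℂ[V]} F^n H`. -/
def HCompleted : Type u := cauchySeq t c ⧸ nullSeq t c

noncomputable instance : Ring (HCompleted t c) :=
  inferInstanceAs (Ring (cauchySeq t c ⧸ nullSeq t c))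

/-- The element of `H̃_{t,c}` represented by a sequence. -/
noncomputable def HCompleted.mk : cauchySeq t c →+* HCompleted t c :=
  Ideal.Quotient.mk (nullSeq t c)

theorem HCompleted.mk_eq {a a' : cauchySeq t c} :
    HCompleted.mk t c a = HCompleted.mk t c a' ↔ a - a' ∈ nullSeq t c :=
  Ideal.Quotient.eq

/-! ### The subring `ℂ[[V]]` -/

variable {ι : Type*} (b : Module.Basis ι ℂ V)

instance : IsMulCommutative (Algebra.adjoin ℂ (Set.range (xHom t c))) :=
  Algebra.isMulCommutative_adjoin ℂ (by
    rintro _ ⟨x, rfl⟩ _ ⟨x', rfl⟩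
    exact x_x t c x x')

open scoped IsMulCommutative in
/-- The homomorphism `ℂ[V] → H_{t,c}`, where `ℂ[V]` is the polynomial ring in the coordinates with
respect to the basis `b`. -/
noncomputable def polyHom : MvPolynomial ι ℂ →ₐ[ℂ] H t c :=
  (Algebra.adjoin ℂ (Set.range (xHom t c))).val.comp
    (MvPolynomial.aeval fun i => ⟨xHom t c (b.coord i), Algebra.subset_adjoin ⟨_, rfl⟩⟩)

theorem polyHom_X (i : ι) : polyHom t c b (MvPolynomial.X i) = xHom t c (b.coord i) := by
  simp [polyHom]

theorem polyHom_monomial (e : ι →₀ ℕ) (r : ℂ) :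
    polyHom t c b (MvPolynomial.monomial e r) ∈ X t c ^ e.degree := by
  induction e using Finsupp.induction_linear generalizing r with
  | zero =>
    have : MvPolynomial.monomial (0 : ι →₀ ℕ) r = algebraMap ℂ _ r := rfl
    rw [this, AlgHom.commutes, map_zero, pow_zero]
    exact Submodule.mem_one.2 ⟨r, rfl⟩
  | add e f he hf =>
    have : MvPolynomial.monomial (e + f) r =
        MvPolynomial.monomial e r * MvPolynomial.monomial f (1 : ℂ) := by
      rw [MvPolynomial.monomial_mul, mul_one]
    rw [this, map_mul, map_add, pow_add]
    exact Submodule.mul_mem_mul (he r) (hf 1)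
  | single i n =>
    have : MvPolynomial.monomial (Finsupp.single i n) r = r • (MvPolynomial.X i) ^ n := by
      rw [MvPolynomial.X_pow_eq_monomial, MvPolynomial.smul_monomial, smul_eq_mul, mul_one]
    rw [this, map_smul, map_pow, polyHom_X, Finsupp.degree_single]
    exact Submodule.smul_mem _ _ (Submodule.pow_mem_pow _ (LinearMap.mem_range_self (xHom t c) (b.coord i)) n)

theorem polyHom_mem (p : MvPolynomial ι ℂ) (k : ℕ) (h : ∀ e, e.degree < k → p.coeff e = 0) :
    polyHom t c b p ∈ IF t c k 0 := by
  rw [p.as_sum, map_sum]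
  refine Submodule.sum_mem _ fun e he => ?_
  have hk : k ≤ e.degree := by
    by_contra hlt
    exact MvPolynomial.mem_support_iff.1 he (h e (not_le.1 hlt))
  have h1 : X t c ^ e.degree ≤ IF t c e.degree 0 := by
    calc X t c ^ e.degree = X t c ^ e.degree * 1 := (mul_one _).symm
      _ ≤ _ := mul_le_mul' le_rfl (one_mem_F t c 0)
  exact IF_anti t c hk (h1 (polyHom_monomial t c b e _))

variable [Fintype ι]

/-- The sequence of polynomial truncations of a formal power series. -/
noncomputable def truncSeq (f : MvPowerSeries ι ℂ) : cauchySeq t c :=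
  ⟨fun k => polyHom t c b (MvPowerSeries.truncTotal k f), 0,
    fun i => IF_le t c 0 0 (polyHom_mem t c b _ 0 fun _ h => absurd h (Nat.not_lt_zero _)),
    fun k => ⟨k, fun i hi j hj => by
      rw [← map_sub]
      refine polyHom_mem t c b _ k fun e he => ?_
      rw [MvPolynomial.coeff_sub, MvPowerSeries.coeff_truncTotal _ (lt_of_lt_of_le he hi),
        MvPowerSeries.coeff_truncTotal _ (lt_of_lt_of_le he hj), sub_self]⟩⟩

/-- The homomorphism `ℂ[[V]] → H̃_{t,c}`, where `ℂ[[V]]` is the ring of formal power series in the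
coordinates with respect to the basis `b`. -/
noncomputable def powerSeriesHom : MvPowerSeries ι ℂ →+* HCompleted t c where
  toFun f := HCompleted.mk t c (truncSeq t c b f)
  map_one' := by
    rw [← map_one (HCompleted.mk t c)]
    refine (HCompleted.mk_eq t c).2 ⟨0, fun k => ⟨1, fun i hi => ?_⟩⟩
    have : (truncSeq t c b 1 - 1).1 i = 0 := by
      show polyHom t c b (MvPowerSeries.truncTotal i 1) - 1 = 0
      rw [MvPowerSeries.truncTotal_one (by omega), map_one, sub_self]
    rw [this]; exact Submodule.zero_mem _
  map_zero' := by
    rw [← map_zero (HCompleted.mk t c)]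
    refine (HCompleted.mk_eq t c).2 ⟨0, fun k => ⟨0, fun i _ => ?_⟩⟩
    have : (truncSeq t c b 0 - 0).1 i = 0 := by
      show polyHom t c b (MvPowerSeries.truncTotal i 0) - 0 = 0
      rw [map_zero, map_zero, sub_zero]
    rw [this]; exact Submodule.zero_mem _
  map_mul' f g := by
    rw [← map_mul (HCompleted.mk t c)]
    refine (HCompleted.mk_eq t c).2 ⟨0, fun k => ⟨k, fun i hi => ?_⟩⟩
    have : (truncSeq t c b (f * g) - truncSeq t c b f * truncSeq t c b g).1 i =
        polyHom t c b (MvPowerSeries.truncTotal i (f * g) -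
          MvPowerSeries.truncTotal i f * MvPowerSeries.truncTotal i g) := by
      rw [map_sub, map_mul (polyHom t c b)]; rfl
    rw [this]
    refine polyHom_mem t c b _ k fun e he => ?_
    have hei := lt_of_lt_of_le he hi
    rw [MvPolynomial.coeff_sub, MvPowerSeries.coeff_truncTotal _ hei,
      MvPowerSeries.coeff_truncTotal_mul_truncTotal_eq_coeff_mul _ _ hei, sub_self]
  map_add' f g := by
    rw [← map_add (HCompleted.mk t c)]
    refine (HCompleted.mk_eq t c).2 ⟨0, fun k => ⟨0, fun i _ => ?_⟩⟩
    have : (truncSeq t c b (f + g) - (truncSeq t c b f + truncSeq t c b g)).1 i = 0 := by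
      show polyHom t c b (MvPowerSeries.truncTotal i (f + g)) -
        (polyHom t c b (MvPowerSeries.truncTotal i f) +
          polyHom t c b (MvPowerSeries.truncTotal i g)) = 0
      rw [map_add, map_add, sub_self]
    rw [this]; exact Submodule.zero_mem _

end Completion

section CategoryO

variable {V : Type u} [AddCommGroup V] [Module ℂ V] {G : Subgroup (V ≃ₗ[ℂ] V)} [Finite G]
  (c : Parameter G) {ι : Type*} [Fintype ι] (b : Module.Basis ι ℂ V)
  (M : Type*) [AddCommGroup M] [Module ℂ M] [Module (H 1 c) M] [IsScalarTower ℂ (H 1 c) M]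

/-- The generalized eigenspace of the Euler element on `M` with eigenvalue `l`. -/
noncomputable def genEig (l : ℂ) : Submodule ℂ M :=
  Module.End.maxGenEigenspace (Algebra.lsmul ℂ ℂ M (euler 1 c b)) l

/-- `M` belongs to category `O` for `H_{1,c}(V, G)`: it is the (automatically direct) sum of its
generalized eigenspaces for the Euler element, these are finite dimensional, and the real parts of
the eigenvalues are bounded from below. -/
structure IsCategoryO : Prop where
  iSup_eq_top : ⨆ l, genEig c b M l = ⊤
  finite : ∀ l, FiniteDimensional ℂ (genEig c b M l)
  bddBelow : ∃ r : ℝ, ∀ l, genEig c b M l ≠ ⊥ → r ≤ l.re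

/-- The sum of the generalized eigenspaces with real part of the eigenvalue at least `r`. -/
noncomputable def geq (r : ℝ) : Submodule ℂ M := ⨆ (l : ℂ) (_ : r ≤ l.re), genEig c b M l

variable {M}

theorem geq_anti {r s : ℝ} (h : r ≤ s) : geq c b M s ≤ geq c b M r :=
  biSup_mono fun _ hl => h.trans hl

variable {c b} in
theorem IsCategoryO.geq_eq_top (hM : IsCategoryO c b M) : ∃ r, geq c b M r = ⊤ := by
  obtain ⟨r, hr⟩ := hM.bddBelow
  refine ⟨r, top_le_iff.1 ?_⟩
  rw [← hM.iSup_eq_top]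
  refine iSup_le fun l => ?_
  by_cases h : genEig c b M l = ⊥
  · rw [h]; exact bot_le
  · exact le_biSup (genEig c b M) (hr l h)

theorem smul_genEig {a : H 1 c} {d : ℂ} (h : euler 1 c b * a = a * euler 1 c b + d • a)
    {l : ℂ} {u : M} (hu : u ∈ genEig c b M l) : a • u ∈ genEig c b M (l + d) := by
  rw [genEig, Module.End.mem_maxGenEigenspace] at hu ⊢
  obtain ⟨k, hk⟩ := hu
  refine ⟨k, ?_⟩
  have key : ∀ (k : ℕ) (u : M),
      ((Algebra.lsmul ℂ ℂ M (euler 1 c b) - (l + d) • (1 : Module.End ℂ M)) ^ k) (a • u) =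
        a • ((Algebra.lsmul ℂ ℂ M (euler 1 c b) - l • (1 : Module.End ℂ M)) ^ k) u := by
    intro k
    induction k with
    | zero => intro u; simp
    | succ k ih =>
      intro u
      have h1 : (Algebra.lsmul ℂ ℂ M (euler 1 c b) - (l + d) • (1 : Module.End ℂ M)) (a • u) =
          a • (Algebra.lsmul ℂ ℂ M (euler 1 c b) - l • (1 : Module.End ℂ M)) u := by
        simp only [LinearMap.sub_apply, Algebra.lsmul_coe, LinearMap.smul_apply,
          Module.End.one_apply]
        have h2 : a • l • u = l • a • u := by
          rw [← algebraMap_smul (H 1 c) l u, ← algebraMap_smul (H 1 c) l (a • u), ← mul_smul,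
            ← mul_smul, Algebra.commutes]
        rw [← mul_smul, h, add_smul, mul_smul, smul_sub, smul_assoc, add_smul, h2]
        abel
      rw [pow_succ, pow_succ, Module.End.mul_apply, Module.End.mul_apply, h1, ih]
  rw [key, hk, smul_zero]

variable (M) in
/-- The elements of `H_{1,c}` that raise the real parts of the eigenvalues by at least `d`. -/
noncomputable def shift (d : ℝ) : Submodule ℂ (H 1 c) where
  carrier := {a | ∀ r, ∀ u ∈ geq c b M r, a • u ∈ geq c b M (r + d)}
  add_mem' ha hb r u hu := by rw [add_smul]; exact Submodule.add_mem _ (ha r u hu) (hb r u hu)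
  zero_mem' r u _ := by rw [zero_smul]; exact Submodule.zero_mem _
  smul_mem' s a ha r u hu := by rw [smul_assoc]; exact Submodule.smul_mem _ _ (ha r u hu)

theorem shift_anti {d e : ℝ} (h : d ≤ e) : shift c b M e ≤ shift c b M d :=
  fun _ ha r u hu => geq_anti c b (by linarith) (ha r u hu)

theorem shift_mul (d e : ℝ) : shift c b M d * shift c b M e ≤ shift c b M (d + e) := by
  rw [Submodule.mul_le]
  intro p hp q hq r u hu
  rw [mul_smul]
  have := hp _ _ (hq r u hu)
  rwa [show r + e + d = r + (d + e) by ring] at this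

theorem mem_shift {a : H 1 c} {d : ℝ}
    (h : euler 1 c b * a = a * euler 1 c b + (d : ℂ) • a) : a ∈ shift c b M d := by
  intro r u hu
  rw [geq] at hu
  induction hu using Submodule.iSup_induction' with
  | zero => rw [smul_zero]; exact Submodule.zero_mem _
  | add x y _ _ hx hy => rw [smul_add]; exact Submodule.add_mem _ hx hy
  | mem l u hu =>
    by_cases hl : r ≤ l.re
    · rw [iSup_pos hl] at hu
      refine Submodule.mem_iSup_of_mem (l + d) (Submodule.mem_iSup_of_mem ?_ (smul_genEig c b h hu))
      simpa using hl
    · rw [iSup_neg hl] at hu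
      rw [(Submodule.mem_bot ℂ).1 hu, smul_zero]; exact Submodule.zero_mem _

theorem one_le_shift : (1 : Submodule ℂ (H 1 c)) ≤ shift c b M 0 := by
  rw [Submodule.one_le]
  intro r u hu
  rw [one_smul, add_zero]; exact hu

theorem X_le_shift : X 1 c ≤ shift c b M 1 := by
  rintro _ ⟨x, rfl⟩
  refine mem_shift c b ?_
  rw [euler_x]; simp

theorem Y_le_shift : Y 1 c ≤ shift c b M (-1) := by
  rintro _ ⟨y, rfl⟩
  refine mem_shift c b ?_
  rw [euler_y]; simp [sub_eq_add_neg]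

theorem B_le_shift : B 1 c ≤ shift c b M 0 := by
  intro a ha
  have ha' : a ∈ Algebra.adjoin ℂ (Set.range (gHom 1 c) ∪ Set.range (xHom 1 c)) := ha
  clear ha
  induction ha' using Algebra.adjoin_induction with
  | mem a h =>
    rcases h with ⟨g, rfl⟩ | ⟨x, rfl⟩
    · refine mem_shift c b ?_
      rw [euler_g]; simp
    · exact shift_anti c b zero_le_one (X_le_shift c b ⟨x, rfl⟩)
  | algebraMap r => exact one_le_shift c b (Submodule.mem_one.2 ⟨r, rfl⟩)
  | add a b ha hb iha ihb => exact Submodule.add_mem _ iha ihb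
  | mul p q hp hq ihp ihq =>
    have := shift_mul c b 0 0 (Submodule.mul_mem_mul ihp ihq)
    rwa [add_zero] at this

theorem F_le_shift (n : ℕ) : F 1 c n ≤ shift c b M (-n) := by
  have h1 : B 1 c * (1 ⊔ Y 1 c) ≤ shift c b M (-1) := by
    calc B 1 c * (1 ⊔ Y 1 c) ≤ shift c b M 0 * shift c b M (-1) :=
          mul_le_mul' (B_le_shift c b)
            (sup_le ((one_le_shift c b).trans (shift_anti c b (by norm_num))) (Y_le_shift c b))
      _ ≤ _ := by simpa using shift_mul c b (M := M) 0 (-1)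
  have h2 : ∀ n : ℕ, (B 1 c * (1 ⊔ Y 1 c)) ^ n ≤ shift c b M (-n) := by
    intro n
    induction n with
    | zero => simpa using one_le_shift c b (M := M)
    | succ n ih =>
      rw [pow_succ]
      refine (mul_le_mul' ih h1).trans ((shift_mul c b _ _).trans (shift_anti c b ?_))
      push_cast; linarith
  refine (mul_le_mul' (h2 n) (B_le_shift c b)).trans ((shift_mul c b _ _).trans (shift_anti c b ?_))
  linarith

theorem IF_le_shift (k n : ℕ) : IF 1 c k n ≤ shift c b M (k - n) := by
  have h : ∀ k : ℕ, X 1 c ^ k ≤ shift c b M k := by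
    intro k
    induction k with
    | zero => simpa using one_le_shift c b (M := M)
    | succ k ih =>
      rw [pow_succ]
      refine (mul_le_mul' ih (X_le_shift c b)).trans ((shift_mul c b _ _).trans (shift_anti c b ?_))
      push_cast; linarith
  refine (mul_le_mul' (h k) (F_le_shift c b n)).trans ((shift_mul c b _ _).trans (shift_anti c b ?_))
  linarith

variable {c}

/-! ### The completion of a module from category `O` -/

/-- The sequences in `M` that are Cauchy for the filtration of `M` by the subspaces
`⨁_{Re l ≥ r} M(l)`; the Cauchy sequences in `H_{1,c}` act on them termwise. -/
noncomputable def cauchySeqModule (hM : IsCategoryO c b M) : Submodule (cauchySeq 1 c) (ℕ → M) where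
  carrier := {m | ∀ r, ∃ N, ∀ i ≥ N, ∀ j ≥ N, m i - m j ∈ geq c b M r}
  add_mem' := by
    rintro m m' h h' r
    obtain ⟨N, hN⟩ := h r
    obtain ⟨N', hN'⟩ := h' r
    refine ⟨max N N', fun i hi j hj => ?_⟩
    rw [Pi.add_apply, Pi.add_apply, add_sub_add_comm]
    exact Submodule.add_mem _ (hN i (le_of_max_le_left hi) j (le_of_max_le_left hj))
      (hN' i (le_of_max_le_right hi) j (le_of_max_le_right hj))
  zero_mem' r := ⟨0, fun i _ j _ => by simp⟩
  smul_mem' := by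
    rintro ⟨a, n, ha, ha'⟩ m hm r
    obtain ⟨B, hB⟩ := hM.geq_eq_top
    obtain ⟨k, hk⟩ := exists_nat_ge (r - B + n)
    obtain ⟨N, hN⟩ := ha' k
    obtain ⟨N', hN'⟩ := hm (r + n)
    refine ⟨max N N', fun i hi j hj => ?_⟩
    have h : a i • m i - a j • m j = (a i - a j) • m i + a j • (m i - m j) := by
      rw [sub_smul, smul_sub]; abel
    show a i • m i - a j • m j ∈ _
    rw [h]
    refine Submodule.add_mem _ ?_ ?_
    · refine geq_anti c b ?_ (IF_le_shift c b k n
        (hN i (le_of_max_le_left hi) j (le_of_max_le_left hj)) B (m i)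
        (hB ▸ Submodule.mem_top))
      linarith
    · refine geq_anti c b ?_ (F_le_shift c b n (ha j) (r + n) _
        (hN' i (le_of_max_le_right hi) j (le_of_max_le_right hj)))
      linarith

/-- The Cauchy sequences in `M` that tend to `0`. -/
noncomputable def nullSeqModule (hM : IsCategoryO c b M) :
    Submodule (cauchySeq 1 c) (cauchySeqModule b hM) where
  carrier := {m | ∀ r, ∃ N, ∀ i ≥ N, m.1 i ∈ geq c b M r}
  add_mem' := by
    rintro m m' h h' r
    obtain ⟨N, hN⟩ := h r
    obtain ⟨N', hN'⟩ := h' r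
    exact ⟨max N N', fun i hi => Submodule.add_mem _ (hN i (le_of_max_le_left hi))
      (hN' i (le_of_max_le_right hi))⟩
  zero_mem' r := ⟨0, fun i _ => Submodule.zero_mem _⟩
  smul_mem' := by
    rintro ⟨a, n, ha, ha'⟩ m hm r
    obtain ⟨N, hN⟩ := hm (r + n)
    refine ⟨N, fun i hi => geq_anti c b ?_ (F_le_shift c b n (ha i) (r + n) _ (hN i hi))⟩
    linarith

/-- The completion `M̃` of a module `M` from category `O` by the grading defined by the
generalized eigenvalues of the Euler element: Cauchy sequences modulo null sequences, for the
filtration of `M` by the subspaces `⨁_{Re l ≥ r} M(l)`. -/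
def Completion (hM : IsCategoryO c b M) : Type _ := cauchySeqModule b hM ⧸ nullSeqModule b hM

noncomputable instance (hM : IsCategoryO c b M) : AddCommGroup (Completion b hM) :=
  inferInstanceAs (AddCommGroup (cauchySeqModule b hM ⧸ nullSeqModule b hM))

theorem isTorsionBySet (hM : IsCategoryO c b M) : Module.IsTorsionBySet (cauchySeq 1 c)
    (cauchySeqModule b hM ⧸ nullSeqModule b hM) (nullSeq 1 c) := by
  intro m a
  obtain ⟨m, rfl⟩ := Submodule.Quotient.mk_surjective _ m
  obtain ⟨⟨a, n', ha, ha'⟩, n, hn⟩ := a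
  show Submodule.Quotient.mk (_ • m) = _
  rw [Submodule.Quotient.mk_eq_zero]
  intro r
  obtain ⟨B, hB⟩ := hM.geq_eq_top
  obtain ⟨k, hk⟩ := exists_nat_ge (r - B + n)
  obtain ⟨N, hN⟩ := hn k
  refine ⟨N, fun i hi => geq_anti c b ?_ (IF_le_shift c b k n (hN i hi) B (m.1 i)
    (hB ▸ Submodule.mem_top))⟩
  linarith

/-- The action of `H̃_{1,c}` on `M̃`: the class of a sequence `a_i` acts on the class of a sequence
`m_i` as the class of the sequence `a_i m_i`. -/
noncomputable instance (hM : IsCategoryO c b M) : Module (HCompleted 1 c) (Completion b hM) :=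
  (isTorsionBySet b hM).module

open CategoryTheory

/-- Category `O` for `H̃_{1,c}(V, G)`: the full subcategory of the category of `H̃_{1,c}`-modules
formed by the modules isomorphic to `M̃` for some `M` from category `O` for `H_{1,c}(V, G)`. -/
def categoryO (c : Parameter G) : ObjectProperty (ModuleCat.{w} (HCompleted 1 c)) := fun N =>
  ∃ (M : Type w) (_ : AddCommGroup M) (_ : Module ℂ M) (_ : Module (H 1 c) M)
    (_ : IsScalarTower ℂ (H 1 c) M) (hM : IsCategoryO c b M),
    Nonempty (N ≃ₗ[HCompleted 1 c] Completion b hM)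

/-- The full subcategory of the category of `H̃_{1,c}`-modules formed by the modules that are
finitely generated over `ℂ[[V]]`. -/
def finiteOverPowerSeries (c : Parameter G) :
    ObjectProperty (ModuleCat.{w} (HCompleted 1 c)) := fun N =>
  Module.Finite (MvPowerSeries ι ℂ)
    ((ModuleCat.restrictScalars (powerSeriesHom 1 c b)).obj N)

end CategoryO

end Cherednik

/-! Write `h` for the Euler element and `I` for the ideal of the origin in `ℂ[V]`. Both directions
rest on comparing two filtrations of a module: the `I`-adic one, and the one by real parts of
generalized eigenvalues of `h`. They are comparable because `h x = x (h + 1)` for `x ∈ V*`.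

From category `O` to finite generation. Write `h = ∑ x_i y_i + z` with `z` in the image of `ℂ[G]`.
This image is finite dimensional, so `Q(z) = 0` for some `Q ≠ 0`; as `h` and `z` commute, `Q(h) = (h
- z) r = ∑ x_i y_i r` with `r` commuting with `h`. If `Q(l) ≠ 0`, then `Q(h)` is invertible on
`M(l)`, hence `M(l) ⊆ ∑ x_i M(l - 1)` (`exists_eq_sum_xHom_smul`). Real parts are bounded below, so
descending in steps of one shows that `M` is generated over `ℂ[V]` by the finitely many finite
dimensional `M(l)` with `Q(l) = 0`, and that vectors of large real part lie in high powers of `I`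
times these generators (`exists_geq_le_polySpan`). A Cauchy sequence in `M` is therefore
`I`-adically Cauchy, and its class is a combination of the same generators with power series
coefficients (`exists_sum_trunc`).

From finite generation to category `O`. Let `N` be finitely generated over `ℂ[[V]]`. The subspaces
`I^k N` have finite codimension, are separated by Krull's intersection theorem, and are complete. If
`P` is the minimal polynomial of `h` on `N / I N`, then `P(h - k)` maps `I^k N` into `I^(k+1) N`.
For a given `l` only finitely many `l - k` are roots of `P`, so a generalized eigenvector modulo
`I^k N` can be corrected step by step, with bounded exponent, to one in `N`. Hence the span `M` of
the generalized eigenvectors is dense; it is an `H`-submodule in category `O`, and on it the two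
filtrations define the same topology (`exists_iSup_le`, `exists_inf_le`). Taking limits identifies
the completion of `M` with `N`.

This identification is linear over `H̃`, and not just over `H`, because the action on `N` is
automatically continuous: `F^n` is finitely generated over `ℂ[V]` (`exists_fg_F_le`), so an element
of `H̃` represented by a sequence in `I^k F^n` is `∑ f_j w_j` with `f_j` of order at least `k`
(`exists_mk_eq_sum`), and it maps `N` into `I^k N`. Only spanning statements about `H` are used,
never the PBW theorem. -/

/-! ### Generalized eigenvectors of an operator on a complete filtered vector space. -/

section ShiftFiltration

open Polynomial

variable {N : Type*} [AddCommGroup N] [Module ℂ N]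

/-- A complete separated filtration by subspaces of finite codimension, stable under `T`, such that
the eigenvalues of `T` on `F k / F (k + 1)` are among the `z + k` with `P(z) = 0`. -/
structure IsShiftFiltration (T : Module.End ℂ N) (F : ℕ → Submodule ℂ N) (P : ℂ[X]) : Prop where
  zero : F 0 = ⊤
  anti : Antitone F
  mapsTo : ∀ k, ∀ u ∈ F k, T u ∈ F k
  ne_zero : P ≠ 0
  shift : ∀ k : ℕ, ∀ u ∈ F k, aeval T (P.comp (X - C (k : ℂ))) u ∈ F (k + 1)
  finite : ∀ k, FiniteDimensional ℂ (N ⧸ F k)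
  separated : ∀ u, (∀ k, u ∈ F k) → u = 0
  complete : ∀ u : ℕ → N, (∀ k, u (k + 1) - u k ∈ F k) → ∃ v, ∀ k, v - u k ∈ F k

theorem aeval_mem_of_mapsTo {T : Module.End ℂ N} {F : Submodule ℂ N} (h : ∀ u ∈ F, T u ∈ F)
    (p : ℂ[X]) {u : N} (hu : u ∈ F) : aeval T p u ∈ F := by
  induction p using Polynomial.induction_on' with
  | add p q hp hq => rw [map_add]; exact F.add_mem hp hq
  | monomial n a =>
    rw [aeval_monomial, Module.End.mul_apply, Module.algebraMap_end_apply]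
    refine F.smul_mem _ ?_
    induction n with
    | zero => simpa
    | succ n ih => rw [pow_succ', Module.End.mul_apply]; exact h _ ih

theorem aeval_mapQ_mkQ {T : Module.End ℂ N} {F : Submodule ℂ N} (h : ∀ u ∈ F, T u ∈ F)
    (p : ℂ[X]) (u : N) : aeval (F.mapQ F T h) p (F.mkQ u) = F.mkQ (aeval T p u) := by
  induction p using Polynomial.induction_on' with
  | add p q hp hq => simp only [map_add, LinearMap.add_apply, hp, hq]
  | monomial n a =>
    simp only [aeval_monomial, Module.End.mul_apply, Module.algebraMap_end_apply, map_smul]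
    congr 1
    induction n with
    | zero => simp
    | succ n ih => rw [pow_succ', pow_succ', Module.End.mul_apply, Module.End.mul_apply, ih]; rfl

theorem isCoprime_of_forall_root {p q : ℂ[X]} (h : ∀ z, p.IsRoot z → ¬ q.IsRoot z) :
    IsCoprime p q := by
  rw [Polynomial.isCoprime_iff_aeval_ne_zero_of_isAlgClosed (K := ℂ) ℂ]
  intro a
  by_cases ha : p.IsRoot a
  · right; simpa [IsRoot] using h a ha
  · left; simpa [IsRoot] using ha

/-- Encodes spectral information on a single vector as an annihilating polynomial, so that all later
arguments reduce to coprimality of polynomials. -/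
theorem exists_aeval_eq_zero_of_mem_iSup {T : Module.End ℂ N} {Z : ℂ → Prop} {u : N}
    (hu : u ∈ ⨆ (l : ℂ) (_ : Z l), T.maxGenEigenspace l) :
    ∃ D : ℂ[X], (∀ z, D.IsRoot z → Z z) ∧ aeval T D u = 0 := by
  induction hu using Submodule.iSup_induction' with
  | zero => exact ⟨1, by simp, by simp⟩
  | add x y _ _ hx hy =>
    obtain ⟨D, hD, hx⟩ := hx
    obtain ⟨E, hE, hy⟩ := hy
    refine ⟨D * E, fun z hz => ?_, ?_⟩
    · rcases root_mul.1 hz with h | h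
      exacts [hD z h, hE z h]
    · rw [map_add]
      nth_rw 1 [mul_comm]
      rw [map_mul, map_mul, Module.End.mul_apply, Module.End.mul_apply, hx, hy]
      simp
  | mem l u hu =>
    by_cases hl : Z l
    · rw [iSup_pos hl, Module.End.mem_maxGenEigenspace] at hu
      obtain ⟨k, hk⟩ := hu
      refine ⟨(X - C l) ^ k, fun z hz => ?_, ?_⟩
      · have : z - l = 0 := by
          rw [IsRoot, eval_pow] at hz
          simpa using eq_zero_of_pow_eq_zero hz
        rwa [sub_eq_zero.1 this]
      · rw [map_pow, map_sub, aeval_X, aeval_C, Algebra.algebraMap_eq_smul_one]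
        exact hk
    · rw [iSup_neg hl, Submodule.mem_bot] at hu
      exact ⟨1, by simp, by simp [hu]⟩

theorem exists_aeval_of_mem_maxGenEigenspace {T : Module.End ℂ N} {l : ℂ} {u : N}
    (hu : u ∈ T.maxGenEigenspace l) :
    ∃ D : ℂ[X], (∀ z, D.IsRoot z → z = l) ∧ aeval T D u = 0 := by
  refine exists_aeval_eq_zero_of_mem_iSup ?_
  rwa [iSup_iSup_eq_left]

namespace IsShiftFiltration

variable {T : Module.End ℂ N} {F : ℕ → Submodule ℂ N} {P : ℂ[X]} (h : IsShiftFiltration T F P)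

include h

/-- Bézout: `D` and `P(X - k)` are coprime, and both map `u` into `F (k + 1)`. So `u` can only sit
strictly at level `k` if `D` has a root among the eigenvalues of that level. -/
theorem mem_succ {D : ℂ[X]} {k : ℕ} (hD : ∀ z, D.IsRoot z → ¬ P.IsRoot (z - k)) {u : N}
    (hu : u ∈ F k) (hDu : aeval T D u ∈ F (k + 1)) : u ∈ F (k + 1) := by
  have hc : IsCoprime D (P.comp (X - C (k : ℂ))) := isCoprime_of_forall_root fun z hz => by
    simpa [IsRoot, eval_comp] using hD z hz
  obtain ⟨a, b, hab⟩ := hc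
  have h1 : u = aeval T a (aeval T D u) + aeval T b (aeval T (P.comp (X - C (k : ℂ))) u) := by
    rw [← Module.End.mul_apply, ← Module.End.mul_apply, ← map_mul, ← map_mul, ← LinearMap.add_apply,
      ← map_add, hab]
    simp
  rw [h1]
  exact Submodule.add_mem _ (aeval_mem_of_mapsTo (h.mapsTo _) _ hDu)
    (aeval_mem_of_mapsTo (h.mapsTo _) _ (h.shift k u hu))

theorem mem_of_aeval_eq_zero {D : ℂ[X]} {k : ℕ}
    (hD : ∀ j < k, ∀ z, D.IsRoot z → ¬ P.IsRoot (z - j)) {u : N} (hDu : aeval T D u = 0) :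
    u ∈ F k := by
  induction k with
  | zero => rw [h.zero]; exact Submodule.mem_top
  | succ k ih =>
    exact h.mem_succ (hD k (Nat.lt_succ_self k)) (ih fun j hj => hD j (hj.trans (Nat.lt_succ_self k)))
      (hDu ▸ Submodule.zero_mem _)

theorem eq_zero_of_aeval_eq_zero {D : ℂ[X]} {k : ℕ}
    (hD : ∀ j ≥ k, ∀ z, D.IsRoot z → ¬ P.IsRoot (z - j)) {u : N} (hu : u ∈ F k)
    (hDu : aeval T D u = 0) : u = 0 := by
  have h1 : ∀ m ≥ k, u ∈ F m := by
    intro m hm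
    induction m, hm using Nat.le_induction with
    | base => exact hu
    | succ m hm ih => exact h.mem_succ (hD m hm) ih (hDu ▸ Submodule.zero_mem _)
  exact h.separated u fun m => h.anti (le_max_left m k) (h1 _ (le_max_right m k))

theorem exists_re_bounds : ∃ r s : ℝ, ∀ z, P.IsRoot z → r ≤ z.re ∧ z.re ≤ s := by
  have hfin : ((fun z : ℂ => z.re) '' {z | P.IsRoot z}).Finite :=
    (Polynomial.finite_setOfPred_isRoot h.ne_zero).image _
  obtain ⟨r, hr⟩ := hfin.bddBelow
  obtain ⟨s, hs⟩ := hfin.bddAbove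
  exact ⟨r, s, fun z hz => ⟨hr ⟨z, hz, rfl⟩, hs ⟨z, hz, rfl⟩⟩⟩

/-- Only finitely many `j : ℕ` are such that `l - j` is a root of `P`. -/
theorem exists_forall_not_isRoot_sub (l : ℂ) : ∃ k : ℕ, ∀ j ≥ k, ¬ P.IsRoot (l - j) := by
  obtain ⟨r, _, hr⟩ := h.exists_re_bounds
  obtain ⟨k, hk⟩ := exists_nat_gt (l.re - r)
  refine ⟨k, fun j hj hj' => ?_⟩
  have h1 := (hr _ hj').1
  have h2 : (k : ℝ) ≤ j := by exact_mod_cast hj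
  simp at h1
  linarith

/-- Beyond some level `k` the eigenvalue `l` no longer occurs, so the eigenspace meets `F k`
trivially and embeds in the finite dimensional quotient. -/
theorem finiteDimensional_maxGenEigenspace (l : ℂ) :
    FiniteDimensional ℂ (T.maxGenEigenspace l) := by
  obtain ⟨k, hk⟩ := h.exists_forall_not_isRoot_sub l
  have := h.finite k
  refine FiniteDimensional.of_injective ((F k).mkQ.comp (T.maxGenEigenspace l).subtype) ?_
  rw [← LinearMap.ker_eq_bot, LinearMap.ker_eq_bot']
  rintro ⟨u, hu⟩ hu0
  have hu0' : u ∈ F k := by simpa using hu0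
  obtain ⟨D, hD, hDu⟩ := exists_aeval_of_mem_maxGenEigenspace hu
  exact Subtype.ext (h.eq_zero_of_aeval_eq_zero (fun j hj z hz => hD z hz ▸ hk j hj) hu0' hDu)

theorem exists_le_re : ∃ r : ℝ, ∀ l, T.maxGenEigenspace l ≠ ⊥ → r ≤ l.re := by
  obtain ⟨r, _, hr⟩ := h.exists_re_bounds
  refine ⟨r, fun l hl => ?_⟩
  by_contra hlt
  refine hl ((Submodule.eq_bot_iff _).2 fun u hu => ?_)
  obtain ⟨D, hD, hDu⟩ := exists_aeval_of_mem_maxGenEigenspace hu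
  refine h.eq_zero_of_aeval_eq_zero (k := 0) (fun j hj z hz hP => ?_)
    (h.zero ▸ Submodule.mem_top) hDu
  rw [hD z hz] at hP
  have h1 := (hr _ hP).1
  have h2 : (0 : ℝ) ≤ j := Nat.cast_nonneg j
  simp at h1
  linarith

/-- One half of the comparison of topologies. With `s` an upper bound for the real parts of the
roots of `P`, the levels below `k` only carry eigenvalues of real part less than `s + k`. -/
theorem exists_iSup_le : ∃ s : ℝ, ∀ (k : ℕ) (r : ℝ), s + k ≤ r →
    ⨆ (l : ℂ) (_ : r ≤ l.re), T.maxGenEigenspace l ≤ F k := by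
  obtain ⟨_, s, hs⟩ := h.exists_re_bounds
  refine ⟨s, fun k r hr u hu => ?_⟩
  obtain ⟨D, hD, hDu⟩ := exists_aeval_eq_zero_of_mem_iSup hu
  refine h.mem_of_aeval_eq_zero (fun j hj z hz hP => ?_) hDu
  have h1 := hD z hz
  have h2 := (hs _ hP).2
  have h3 : (j : ℝ) < k := by exact_mod_cast hj
  simp at h2
  linarith

/-- The other half. Here `s` is a lower bound for the real parts of the roots, so levels from `k` on
only carry eigenvalues of real part at least `s + k`, and the low part of a vector of `F k` must
vanish. -/
theorem exists_inf_le : ∃ s : ℝ, ∀ (k : ℕ) (r : ℝ), r ≤ s + k →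
    (⨆ l : ℂ, T.maxGenEigenspace l) ⊓ F k ≤ ⨆ (l : ℂ) (_ : r ≤ l.re), T.maxGenEigenspace l := by
  obtain ⟨s, _, hs⟩ := h.exists_re_bounds
  refine ⟨s, fun k r hr u hu => ?_⟩
  obtain ⟨hu, huk⟩ := hu
  have hsplit : (⨆ l : ℂ, T.maxGenEigenspace l) ≤
      (⨆ (l : ℂ) (_ : l.re < r), T.maxGenEigenspace l) ⊔
        ⨆ (l : ℂ) (_ : r ≤ l.re), T.maxGenEigenspace l := by
    refine iSup_le fun l => ?_
    rcases lt_or_ge l.re r with hl | hl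
    · exact le_sup_of_le_left (le_iSup₂_of_le l hl le_rfl)
    · exact le_sup_of_le_right (le_iSup₂_of_le l hl le_rfl)
  obtain ⟨v, hv, w, hw, rfl⟩ := Submodule.mem_sup.1 (hsplit hu)
  obtain ⟨D, hD, hDv⟩ := exists_aeval_eq_zero_of_mem_iSup hv
  obtain ⟨E, hE, hEw⟩ := exists_aeval_eq_zero_of_mem_iSup hw
  obtain ⟨p, q, hpq⟩ := isCoprime_of_forall_root (p := D) (q := E) fun z hz hz' =>
    absurd (hD z hz) (not_lt.2 (hE z hz'))
  -- The low component `v` is a polynomial in `T` applied to `v + w`, so it stays in the `T`-stable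
  -- subspace `F k`.
  have hv' : v = aeval T (q * E) (v + w) := by
    have h1 : v = aeval T (p * D + q * E) v := by rw [hpq]; simp
    rw [map_add, map_mul, LinearMap.add_apply, Module.End.mul_apply, hDv, map_zero, zero_add] at h1
    rw [map_add, ← h1, map_mul, Module.End.mul_apply, hEw, map_zero, add_zero]
  have hv0 : v = 0 := by
    refine h.eq_zero_of_aeval_eq_zero (k := k) (fun j hj z hz hP => ?_)
      (hv' ▸ aeval_mem_of_mapsTo (h.mapsTo k) _ huk) hDv
    have h1 := hD z hz
    have h2 := (hs _ hP).1
    have h3 : (k : ℝ) ≤ j := by exact_mod_cast hj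
    simp at h2
    linarith
  rwa [hv0, zero_add]

/-- A generalized eigenvector modulo `F k` can be corrected to one modulo `F (k + 1)`. -/
theorem exists_lift_succ (l : ℂ) (k : ℕ) {n : ℕ} {u : N}
    (hu : aeval T ((X - C l) ^ n) u ∈ F k) :
    ∃ u', u' - u ∈ F k ∧
      aeval T ((X - C l) ^ (n + (P.comp (X - C (k : ℂ))).rootMultiplicity l)) u' ∈ F (k + 1) := by
  set p := P.comp (X - C (k : ℂ)) with hp
  have hp0 : p ≠ 0 := by
    intro h0
    rw [hp, comp_eq_zero_iff] at h0
    rcases h0 with h0 | ⟨-, h0⟩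
    · exact h.ne_zero h0
    · have := congrArg (fun q => q.coeff 1) h0
      simp [coeff_X] at this
  -- Split off the `l`-part, `p = (X - l)^r D` with `D(l) ≠ 0`. The corrected vector is the
  -- projection `(b D)(T) u`, where `a (X - l)^n + b D = 1`.
  obtain ⟨D, hpD, hD⟩ := exists_eq_pow_rootMultiplicity_mul_and_not_dvd p hp0 l
  set r := p.rootMultiplicity l
  obtain ⟨a, b, hab⟩ := isCoprime_of_forall_root (p := (X - C l) ^ n) (q := D) fun z hz hz' => by
    refine hD (dvd_iff_isRoot.2 ?_)
    have h1 : z = l := by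
      rcases n with _ | n
      · simp at hz
      · simpa [IsRoot, sub_eq_zero] using hz
    rwa [← h1]
  refine ⟨aeval T (b * D) u, ?_, ?_⟩
  · have h1 : u = aeval T (a * (X - C l) ^ n + b * D) u := by rw [hab]; simp
    have h2 : aeval T (b * D) u - u = - aeval T a (aeval T ((X - C l) ^ n) u) := by
      rw [map_add, LinearMap.add_apply, map_mul, Module.End.mul_apply] at h1
      nth_rw 2 [h1]
      abel
    rw [h2]
    exact Submodule.neg_mem _ (aeval_mem_of_mapsTo (h.mapsTo k) _ hu)
  · rw [← Module.End.mul_apply, ← map_mul,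
      show (X - C l) ^ (n + r) * (b * D) = b * (p * (X - C l) ^ n) by rw [hpD]; ring,
      map_mul, Module.End.mul_apply, map_mul, Module.End.mul_apply]
    exact aeval_mem_of_mapsTo (h.mapsTo _) _ (h.shift k _ hu)

/-- Iterate the correction through all levels and take the limit. The limit is a generalized
eigenvector because the exponents stabilise: a level raises the exponent only if `l` is an
eigenvalue there, which happens finitely often. -/
theorem exists_mem_maxGenEigenspace_sub_mem {l : ℂ} {k n : ℕ} {u : N}
    (hu : aeval T ((X - C l) ^ n) u ∈ F k) : ∃ v ∈ T.maxGenEigenspace l, v - u ∈ F k := by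
  choose! f hf hf' using fun (k n : ℕ) (u : N) => h.exists_lift_succ l k (n := n) (u := u)
  let r : ℕ → ℕ := fun j => (P.comp (X - C (j : ℂ))).rootMultiplicity l
  let e : ℕ → ℕ := fun j => n + ∑ i ∈ Finset.range j, r (k + i)
  let s : ℕ → N := fun j => Nat.rec u (fun i w => f (k + i) (e i) w) j
  have hs : ∀ j, aeval T ((X - C l) ^ (e j)) (s j) ∈ F (k + j) := by
    intro j
    induction j with
    | zero => simpa [e, s] using hu
    | succ j ih =>
      have := hf' (k + j) (e j) (s j) ih
      rw [show e (j + 1) = e j + r (k + j) by simp [e, Finset.sum_range_succ, add_assoc]]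
      exact this
  have hs' : ∀ j, s (j + 1) - s j ∈ F (k + j) := fun j => hf (k + j) (e j) (s j) (hs j)
  obtain ⟨v, hv⟩ := h.complete s fun j => h.anti (Nat.le_add_left j k) (hs' j)
  obtain ⟨K, hK⟩ := h.exists_forall_not_isRoot_sub l
  have he : ∀ j, e (K + j) = e K := by
    intro j
    induction j with
    | zero => rfl
    | succ j ih =>
      rw [← ih]
      have : r (k + (K + j)) = 0 := by
        refine rootMultiplicity_eq_zero ?_
        have := hK (k + (K + j)) (by omega)
        simpa [IsRoot, eval_comp] using this
      simp only [e, ← add_assoc K j 1, Finset.sum_range_succ, this, add_zero]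
  refine ⟨v, ?_, ?_⟩
  · rw [Module.End.mem_maxGenEigenspace]
    refine ⟨e K, h.separated _ fun m => ?_⟩
    have h1 : aeval T ((X - C l) ^ (e K)) v =
        aeval T ((X - C l) ^ (e K)) (v - s (K + m)) + aeval T ((X - C l) ^ (e (K + m))) (s (K + m)) := by
      rw [he, ← map_add, sub_add_cancel]
    have h2 : aeval T ((X - C l) ^ (e K)) v ∈ F m := by
      rw [h1]
      exact Submodule.add_mem _ (aeval_mem_of_mapsTo (h.mapsTo _) _ (h.anti (by omega) (hv _)))
        (h.anti (by omega) (hs _))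
    rwa [map_pow, map_sub, aeval_X, aeval_C, Algebra.algebraMap_eq_smul_one] at h2
  · have h1 : ∀ j, s j - u ∈ F k := by
      intro j
      induction j with
      | zero => simp [s]
      | succ j ih =>
        rw [← sub_add_sub_cancel _ (s j)]
        exact Submodule.add_mem _ (h.anti (by omega) (hs' j)) ih
    -- Completeness was applied with `s (j + 1) - s j ∈ F j` only, so the limit is compared with the
    -- term `s k`, which is still congruent to `u` modulo `F k`.
    rw [← sub_add_sub_cancel _ (s k)]
    exact Submodule.add_mem _ (hv k) (h1 k)

/-- Density of the generalized eigenvectors: they span the finite dimensional quotient `N / F k`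
over `ℂ`, and each one lifts to `N`. -/
theorem iSup_maxGenEigenspace_sup (k : ℕ) : (⨆ l : ℂ, T.maxGenEigenspace l) ⊔ F k = ⊤ := by
  have := h.finite k
  let S : Module.End ℂ (N ⧸ F k) := (F k).mapQ (F k) T (h.mapsTo k)
  have hS := aeval_mapQ_mkQ (h.mapsTo k)
  rw [eq_top_iff]
  intro u _
  have hu : (F k).mkQ u ∈ ⨆ l : ℂ, S.maxGenEigenspace l := by
    rw [Module.End.iSup_maxGenEigenspace_eq_top]; exact Submodule.mem_top
  have key : (⨆ l : ℂ, S.maxGenEigenspace l) ≤ (⨆ l : ℂ, T.maxGenEigenspace l).map (F k).mkQ := by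
    refine iSup_le fun l w hw => ?_
    obtain ⟨u, rfl⟩ := (F k).mkQ_surjective w
    obtain ⟨n, hn⟩ := (Module.End.mem_maxGenEigenspace _ _ _).1 hw
    have hn' : aeval T ((X - C l) ^ n) u ∈ F k := by
      have h1 := hS ((X - C l) ^ n) u
      rw [map_pow, map_sub, aeval_X, aeval_C, Algebra.algebraMap_eq_smul_one, hn] at h1
      exact (Submodule.Quotient.mk_eq_zero _).1 h1.symm
    obtain ⟨v, hv, hvu⟩ := h.exists_mem_maxGenEigenspace_sub_mem hn'
    refine ⟨v, Submodule.mem_iSup_of_mem l hv, ?_⟩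
    exact (Submodule.Quotient.eq _).2 hvu
  obtain ⟨v, hv, hvu⟩ := key hu
  rw [← sub_add_cancel u v, add_comm]
  refine Submodule.add_mem_sup hv ?_
  exact (Submodule.Quotient.eq _).1 hvu.symm

end IsShiftFiltration

end ShiftFiltration

/-! ### The order filtration of a power series ring. -/

namespace MvPowerSeries

variable {σ R : Type*} [CommRing R]

variable (σ R) in
/-- The ideal of the power series without terms of degree less than `k`. -/
def orderIdeal (k : ℕ) : Ideal (MvPowerSeries σ R) where
  carrier := {f | ∀ e : σ →₀ ℕ, e.degree < k → coeff e f = 0}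
  add_mem' hf hg e he := by rw [map_add, hf e he, hg e he, add_zero]
  zero_mem' e _ := map_zero _
  smul_mem' g f hf e he := by
    classical
    rw [smul_eq_mul, coeff_mul]
    refine Finset.sum_eq_zero fun p hp => ?_
    have h1 := Finset.HasAntidiagonal.mem_antidiagonal.1 hp
    rw [hf p.2 (lt_of_le_of_lt (by rw [← h1, map_add]; omega) he), mul_zero]

theorem orderIdeal_anti : Antitone (orderIdeal σ R) :=
  fun _ _ h _ hf e he => hf e (he.trans_le h)

theorem mul_mem_orderIdeal {k l : ℕ} {f g : MvPowerSeries σ R} (hf : f ∈ orderIdeal σ R k)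
    (hg : g ∈ orderIdeal σ R l) : f * g ∈ orderIdeal σ R (k + l) := by
  classical
  intro e he
  rw [coeff_mul]
  refine Finset.sum_eq_zero fun p hp => ?_
  have h1 := congrArg Finsupp.degree (Finset.HasAntidiagonal.mem_antidiagonal.1 hp)
  rw [map_add] at h1
  rcases lt_or_ge p.1.degree k with h | h
  · rw [hf _ h, zero_mul]
  · rw [hg p.2 (by omega), mul_zero]

theorem exists_eq_sum_X_mul [Fintype σ] {k : ℕ} {f : MvPowerSeries σ R}
    (hf : f ∈ orderIdeal σ R (k + 1)) :
    ∃ g : σ → MvPowerSeries σ R, (∀ i, g i ∈ orderIdeal σ R k) ∧ f = ∑ i, X i * g i := by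
  classical
  -- Without variables the only exponent is `0`, of degree less than `k + 1`, so `f = 0`. The choice
  -- function below needs `σ` nonempty.
  rcases isEmpty_or_nonempty σ with hσ | hσ
  · refine ⟨fun _ => 0, fun _ => zero_mem _, ?_⟩
    ext e
    rw [hf e (by simp [Subsingleton.elim e 0])]
    simp
  have hsupp : ∀ e : σ →₀ ℕ, e ≠ 0 → ∃ i, i ∈ e.support := fun e he =>
    Finsupp.support_nonempty_iff.2 he
  choose! v hv using hsupp
  -- Each monomial of positive degree is charged to one chosen variable `v e` dividing it; `g i`
  -- collects the monomials charged to `i`, divided by `X i`.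
  let g : σ → MvPowerSeries σ R := fun i d =>
    if v (d + Finsupp.single i 1) = i then coeff (d + Finsupp.single i 1) f else 0
  have hg : ∀ i d, coeff d (g i) =
    if v (d + Finsupp.single i 1) = i then coeff (d + Finsupp.single i 1) f else 0 := fun _ _ => rfl
  refine ⟨g, fun i d hd => ?_, ?_⟩
  · rw [hg]
    split_ifs
    · exact hf _ (by rw [map_add, Finsupp.degree_single]; omega)
    · rfl
  · ext e
    rw [map_sum]
    by_cases he : e = 0
    · subst he
      rw [hf 0 (by simp)]
      exact (Finset.sum_eq_zero fun i _ => by simp [coeff_zero_X_mul]).symm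
    · have h0 : e (v e) ≠ 0 := Finsupp.mem_support_iff.1 (hv e he)
      have key : ∀ i, coeff e (X i * g i) = if i = v e then coeff e f else 0 := by
        intro i
        rw [X, coeff_monomial_mul]
        by_cases hi : Finsupp.single i 1 ≤ e
        · rw [if_pos hi, one_mul, hg, tsub_add_cancel_of_le hi]
          simp only [eq_comm]
        · rw [if_neg hi, if_neg]
          rintro rfl
          exact hi (Finsupp.single_le_iff.2 (Nat.one_le_iff_ne_zero.2 h0))
      rw [Finset.sum_congr rfl fun i _ => key i]
      simp

theorem pow_span_X [Fintype σ] (k : ℕ) :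
    Ideal.span (Set.range (X : σ → MvPowerSeries σ R)) ^ k = orderIdeal σ R k := by
  classical
  induction k with
  | zero =>
    rw [pow_zero, Ideal.one_eq_top, eq_comm, eq_top_iff]
    exact fun f _ e he => absurd he (Nat.not_lt_zero _)
  | succ k ih =>
    rw [pow_succ', ih]
    refine le_antisymm (Ideal.mul_le.2 fun f hf g hg => ?_) fun f hf => ?_
    · rw [add_comm]
      refine mul_mem_orderIdeal ?_ hg
      have : Ideal.span (Set.range (X : σ → MvPowerSeries σ R)) ≤ orderIdeal σ R 1 := by
        rw [Ideal.span_le]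
        rintro _ ⟨i, rfl⟩ e he
        have : e = 0 := by
          rw [← Finsupp.degree_eq_zero_iff]; omega
        rw [this, coeff_zero_X]
      exact this hf
    · obtain ⟨g, hg, rfl⟩ := exists_eq_sum_X_mul hf
      exact Ideal.sum_mem _ fun i _ =>
        Ideal.mul_mem_mul (Ideal.subset_span ⟨i, rfl⟩) (hg i)

/-- Summation of a series of increasing orders: the coefficient at `e` only involves the terms with
`k ≤ e.degree`. -/
theorem exists_sub_sum_mem (p : ℕ → MvPowerSeries σ R) (hp : ∀ k, p k ∈ orderIdeal σ R k) :
    ∃ f, ∀ K, f - ∑ k ∈ Finset.range K, p k ∈ orderIdeal σ R K := by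
  let f : MvPowerSeries σ R := fun e => ∑ k ∈ Finset.range (e.degree + 1), coeff e (p k)
  have hf : ∀ e, coeff e f = ∑ k ∈ Finset.range (e.degree + 1), coeff e (p k) := fun _ => rfl
  refine ⟨f, fun K e he => ?_⟩
  rw [map_sub, map_sum, sub_eq_zero, hf]
  refine Finset.sum_subset (Finset.range_subset_range.2 (by omega)) fun k _ hk => ?_
  exact hp k e (by simpa using hk)

end MvPowerSeries

namespace Cherednik

/-! ### The map from `H` to its completion, and finite generation of the filtration steps over
`ℂ[V]`. -/

section Completion

variable {V : Type u} [AddCommGroup V] [Module ℂ V] {G : Subgroup (V ≃ₗ[ℂ] V)} [Finite G]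
  {t : ℂ} {c : Parameter G}

theorem H_induction {p : H t c → Prop} (hC : ∀ r, p (algebraMap ℂ _ r)) (hg : ∀ g, p (gHom t c g))
    (hy : ∀ y, p (yHom t c y)) (hx : ∀ x, p (xHom t c x)) (hadd : ∀ a b, p a → p b → p (a + b))
    (hmul : ∀ a b, p a → p b → p (a * b)) (a : H t c) : p a := by
  obtain ⟨a, rfl⟩ := RingQuot.mkAlgHom_surjective ℂ (Rel t c) a
  induction a using FreeAlgebra.induction with
  | grade0 r => rw [AlgHom.commutes]; exact hC r
  | grade1 z =>
    cases z with
    | ofG g => exact hg g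
    | ofV y => exact hy y
    | ofDual x => exact hx x
  | mul a b ha hb => rw [map_mul]; exact hmul _ _ ha hb
  | add a b ha hb => rw [map_add]; exact hadd _ _ ha hb

theorem B_le_F (n : ℕ) : B t c ≤ F t c n := by
  rw [← B_F]
  calc B t c = B t c * 1 := (mul_one _).symm
    _ ≤ _ := mul_le_mul' le_rfl (one_mem_F t c n)

theorem exists_mem_F (a : H t c) : ∃ n, a ∈ F t c n := by
  induction a using H_induction with
  | hC r => exact ⟨0, one_mem_F t c 0 (Submodule.mem_one.2 ⟨r, rfl⟩)⟩
  | hg g => exact ⟨0, B_le_F 0 (Algebra.subset_adjoin (Or.inl ⟨g, rfl⟩))⟩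
  | hy y => exact ⟨1, Y_le_F t c ⟨y, rfl⟩⟩
  | hx x => exact ⟨0, B_le_F 0 (Algebra.subset_adjoin (Or.inr ⟨x, rfl⟩))⟩
  | hadd a b ha hb =>
    obtain ⟨m, ha⟩ := ha
    obtain ⟨n, hb⟩ := hb
    exact ⟨max m n, add_mem (F_mono t c (le_max_left _ _) ha) (F_mono t c (le_max_right _ _) hb)⟩
  | hmul a b ha hb =>
    obtain ⟨m, ha⟩ := ha
    obtain ⟨n, hb⟩ := hb
    exact ⟨m + n, F_mul t c m n ▸ Submodule.mul_mem_mul ha hb⟩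

variable (t c) in
/-- The constant sequences. -/
noncomputable def constSeq : H t c →+* cauchySeq t c :=
  (Pi.constRingHom ℕ (H t c)).codRestrict (cauchySeq t c).toSubring.toSubsemiring fun a => by
    obtain ⟨n, hn⟩ := exists_mem_F a
    exact ⟨n, fun _ => hn, fun k => ⟨0, fun i _ j _ => by simp⟩⟩

variable (t c) in
/-- The homomorphism `H → H̃`. -/
noncomputable def toHCompleted : H t c →+* HCompleted t c := (HCompleted.mk t c).comp (constSeq t c)

/-! ### Generators of `F^n` over `ℂ[V]` -/

variable {ι : Type*} (b : Module.Basis ι ℂ V)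

variable (t c) in
/-- The subspace `ℂ[V]` of `H_{t,c}`. -/
noncomputable def polys : Submodule ℂ (H t c) := Subalgebra.toSubmodule (polyHom t c b).range

variable (t c) in
/-- The subspace `ℂ[G]` of `H_{t,c}`. -/
noncomputable def groupSpan : Submodule ℂ (H t c) := Submodule.span ℂ (Set.range (gHom t c))

theorem polys_mul_polys : polys t c b * polys t c b = polys t c b :=
  (Subalgebra.isIdempotentElem_toSubmodule _).eq

theorem one_le_polys : 1 ≤ polys t c b := Submodule.one_le.2 (one_mem (polyHom t c b).range)

theorem gHom_mem_groupSpan (g : G) : gHom t c g ∈ groupSpan t c := Submodule.subset_span ⟨g, rfl⟩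

theorem groupSpan_mul_groupSpan : groupSpan t c * groupSpan t c ≤ groupSpan t c := by
  rw [groupSpan, Submodule.span_mul_span, Submodule.span_le]
  rintro _ ⟨_, ⟨g, rfl⟩, _, ⟨g', rfl⟩, rfl⟩
  exact Submodule.subset_span ⟨g * g', map_mul _ _ _⟩

theorem one_le_groupSpan : 1 ≤ groupSpan t c :=
  Submodule.one_le.2 (map_one (gHom t c) ▸ gHom_mem_groupSpan 1)

theorem groupSpan_le_B : groupSpan t c ≤ B t c := by
  rw [groupSpan, Submodule.span_le]
  rintro _ ⟨g, rfl⟩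
  exact Algebra.subset_adjoin (Or.inl ⟨g, rfl⟩)

theorem xHom_eq_polyHom [Fintype ι] (x : Module.Dual ℂ V) :
    xHom t c x = polyHom t c b (∑ i, x (b i) • MvPolynomial.X i) := by
  rw [map_sum, ← Module.Basis.sum_dual_apply_smul_coord b x, map_sum]
  simp only [map_smul, polyHom_X, Module.Basis.sum_dual_apply_smul_coord]

theorem X_le_polys [Fintype ι] : X t c ≤ polys t c b := by
  rintro _ ⟨x, rfl⟩
  exact ⟨_, (xHom_eq_polyHom b x).symm⟩

theorem gHom_mul_polyHom [Fintype ι] (g : G) (p : MvPolynomial ι ℂ) :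
    ∃ q, gHom t c g * polyHom t c b p = polyHom t c b q * gHom t c g := by
  induction p using MvPolynomial.induction_on with
  | C r =>
    refine ⟨MvPolynomial.C r, ?_⟩
    rw [← MvPolynomial.algebraMap_eq, AlgHom.commutes, Algebra.commutes]
  | add p q hp hq =>
    obtain ⟨p', hp⟩ := hp
    obtain ⟨q', hq⟩ := hq
    exact ⟨p' + q', by rw [map_add, map_add, mul_add, add_mul, hp, hq]⟩
  | mul_X p i hp =>
    obtain ⟨q, hq⟩ := hp
    refine ⟨q * ∑ j, dualAct g.1 (b.coord i) (b j) • MvPolynomial.X j, ?_⟩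
    rw [map_mul, map_mul, ← mul_assoc, hq, mul_assoc, polyHom_X, g_x, xHom_eq_polyHom b, mul_assoc]

theorem groupSpan_mul_polys [Fintype ι] :
    groupSpan t c * polys t c b ≤ polys t c b * groupSpan t c := by
  rw [Submodule.mul_le]
  rintro a ha _ ⟨p, rfl⟩
  induction ha using Submodule.span_induction with
  | mem a ha =>
    obtain ⟨g, rfl⟩ := ha
    obtain ⟨q, hq⟩ := gHom_mul_polyHom (t := t) (c := c) b g p
    show gHom t c g * polyHom t c b p ∈ _
    rw [hq]
    exact Submodule.mul_mem_mul ⟨q, rfl⟩ (gHom_mem_groupSpan g)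
  | zero => rw [zero_mul]; exact zero_mem _
  | add x y _ _ hx hy => rw [add_mul]; exact add_mem hx hy
  | smul r x _ hx => rw [smul_mul_assoc]; exact Submodule.smul_mem _ r hx

/-- `G` normalises `ℂ[V]`, so the product `ℂ[V] ℂ[G]` is closed under multiplication; it contains
the generators of `B`. -/
theorem B_le_polys_mul [Fintype ι] : B t c ≤ polys t c b * groupSpan t c := by
  have h1 : (1 : Submodule ℂ (H t c)) ≤ polys t c b * groupSpan t c := by
    calc (1 : Submodule ℂ (H t c)) = 1 * 1 := (one_mul 1).symm
      _ ≤ _ := mul_le_mul' (one_le_polys b) one_le_groupSpan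
  have h2 : polys t c b * groupSpan t c * (polys t c b * groupSpan t c) ≤
      polys t c b * groupSpan t c := by
    calc _ = polys t c b * (groupSpan t c * polys t c b) * groupSpan t c := by
          simp only [mul_assoc]
      _ ≤ polys t c b * (polys t c b * groupSpan t c) * groupSpan t c :=
          mul_le_mul' (mul_le_mul' le_rfl (groupSpan_mul_polys b)) le_rfl
      _ = polys t c b * polys t c b * (groupSpan t c * groupSpan t c) := by simp only [mul_assoc]
      _ ≤ _ := mul_le_mul' (polys_mul_polys b).le groupSpan_mul_groupSpan
  intro a ha
  have ha' : a ∈ Algebra.adjoin ℂ (Set.range (gHom t c) ∪ Set.range (xHom t c)) := ha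
  clear ha
  induction ha' using Algebra.adjoin_induction with
  | mem a h =>
    rcases h with ⟨g, rfl⟩ | ⟨x, rfl⟩
    · have := Submodule.mul_mem_mul (Submodule.one_le.1 (one_le_polys (t := t) (c := c) b))
        (gHom_mem_groupSpan (t := t) (c := c) g)
      rwa [one_mul] at this
    · have := Submodule.mul_mem_mul (X_le_polys (t := t) (c := c) b ⟨x, rfl⟩)
        (Submodule.one_le.1 (one_le_groupSpan (t := t) (c := c)))
      rwa [mul_one] at this
  | algebraMap r => exact h1 (Submodule.mem_one.2 ⟨r, rfl⟩)
  | add a b ha hb iha ihb => exact add_mem iha ihb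
  | mul a b ha hb iha ihb => exact h2 (Submodule.mul_mem_mul iha ihb)

/-- Moving `y` past one coordinate leaves an error in `B ⊆ ℂ[V] ℂ[G]`, and the right-hand side is
stable under right multiplication by further coordinates. -/
theorem Y_mul_polys [Fintype ι] :
    Y t c * polys t c b ≤ polys t c b * Y t c ⊔ polys t c b * groupSpan t c := by
  have h1 : (polys t c b * Y t c ⊔ polys t c b * groupSpan t c) * X t c ≤
      polys t c b * Y t c ⊔ polys t c b * groupSpan t c := by
    rw [Submodule.sup_mul, mul_assoc, mul_assoc]
    refine sup_le ?_ ?_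
    · calc polys t c b * (Y t c * X t c)
          ≤ polys t c b * (polys t c b * Y t c ⊔ polys t c b * groupSpan t c) :=
            mul_le_mul' le_rfl ((Y_X t c).trans
              (sup_le_sup (mul_le_mul' (X_le_polys b) le_rfl) (B_le_polys_mul b)))
        _ = _ := by rw [Submodule.mul_sup, ← mul_assoc, ← mul_assoc, polys_mul_polys]
    · refine le_trans ?_ le_sup_right
      calc polys t c b * (groupSpan t c * X t c)
          ≤ polys t c b * (polys t c b * groupSpan t c) :=
            mul_le_mul' le_rfl ((mul_le_mul' le_rfl (X_le_polys b)).trans (groupSpan_mul_polys b))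
        _ = _ := by rw [← mul_assoc, polys_mul_polys]
  rw [Submodule.mul_le]
  rintro y hy _ ⟨p, rfl⟩
  show y * polyHom t c b p ∈ _
  induction p using MvPolynomial.induction_on with
  | C r =>
    rw [← MvPolynomial.algebraMap_eq, AlgHom.commutes, ← Algebra.commutes]
    exact Submodule.mem_sup_left (Submodule.mul_mem_mul
      (one_le_polys b (Submodule.mem_one.2 ⟨r, rfl⟩)) hy)
  | add p q hp hq => rw [map_add, mul_add]; exact add_mem hp hq
  | mul_X p i hp =>
    rw [map_mul, ← mul_assoc, polyHom_X]
    exact h1 (Submodule.mul_mem_mul hp ⟨_, rfl⟩)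

/-- `F^n` is finitely generated over `ℂ[V]`. -/
theorem exists_fg_F_le [Fintype ι] (n : ℕ) :
    ∃ E : Submodule ℂ (H t c), E.FG ∧ E ≤ F t c n ∧ F t c n ≤ polys t c b * E := by
  have hG : (groupSpan t c).FG := Submodule.fg_span (Set.finite_range _)
  have hY : (Y t c).FG := by
    have := Module.Finite.of_basis b
    exact Module.Finite.iff_fg.1 (inferInstanceAs (Module.Finite ℂ (LinearMap.range (yHom t c))))
  have h1 : (1 : Submodule ℂ (H t c)).FG := by
    rw [Submodule.one_eq_span]; exact Submodule.fg_span_singleton _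
  induction n with
  | zero =>
    exact ⟨groupSpan t c, hG, groupSpan_le_B.trans (B_le_F 0), by
      simpa [F] using B_le_polys_mul (t := t) (c := c) b⟩
  | succ n ih =>
    obtain ⟨E, hE, hEF, hFE⟩ := ih
    -- The inner summand `groupSpan` absorbs the commutator terms produced when `Y` is moved past
    -- the polynomial coefficients of `F^n`.
    refine ⟨groupSpan t c * ((1 ⊔ Y t c ⊔ groupSpan t c) * E),
      hG.mul (((h1.sup hY).sup hG).mul hE), ?_, ?_⟩
    · calc groupSpan t c * ((1 ⊔ Y t c ⊔ groupSpan t c) * E)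
          ≤ B t c * (F t c 1 * F t c n) := mul_le_mul' groupSpan_le_B (mul_le_mul'
            (sup_le (sup_le (one_mem_F t c 1) (Y_le_F t c)) (groupSpan_le_B.trans (B_le_F 1))) hEF)
        _ = _ := by rw [F_mul, B_F, add_comm]
    · have h2 : (1 ⊔ Y t c) * polys t c b ≤ polys t c b * (1 ⊔ Y t c ⊔ groupSpan t c) := by
        rw [Submodule.sup_mul, Submodule.mul_sup, Submodule.mul_sup, one_mul, mul_one]
        exact sup_le (le_sup_of_le_left le_sup_left) ((Y_mul_polys b).trans
          (sup_le_sup le_sup_right le_rfl))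
      calc F t c (n + 1) = B t c * ((1 ⊔ Y t c) * F t c n) := by
            rw [F, pow_succ']; simp only [F, mul_assoc]
        _ ≤ polys t c b * groupSpan t c * ((1 ⊔ Y t c) * (polys t c b * E)) :=
            mul_le_mul' (B_le_polys_mul b) (mul_le_mul' le_rfl hFE)
        _ = polys t c b * groupSpan t c * ((1 ⊔ Y t c) * polys t c b * E) := by
            rw [mul_assoc (1 ⊔ Y t c)]
        _ ≤ polys t c b * groupSpan t c * (polys t c b * (1 ⊔ Y t c ⊔ groupSpan t c) * E) :=
            mul_le_mul' le_rfl (mul_le_mul' h2 le_rfl)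
        _ = polys t c b * (groupSpan t c * polys t c b) * ((1 ⊔ Y t c ⊔ groupSpan t c) * E) := by
            simp only [mul_assoc]
        _ ≤ polys t c b * (polys t c b * groupSpan t c) * ((1 ⊔ Y t c ⊔ groupSpan t c) * E) :=
            mul_le_mul' (mul_le_mul' le_rfl (groupSpan_mul_polys b)) le_rfl
        _ = _ := by rw [← mul_assoc (polys t c b), polys_mul_polys, mul_assoc]

end Completion

/-! ### Adic limits of polynomial combinations of finitely many vectors. -/

section PolySpan

variable {V : Type u} [AddCommGroup V] [Module ℂ V] {G : Subgroup (V ≃ₗ[ℂ] V)} [Finite G]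
  {t : ℂ} {c : Parameter G} {ι : Type*} (b : Module.Basis ι ℂ V)
  {A : Type*} [AddCommGroup A] [Module ℂ A] [Module (H t c) A] [IsScalarTower ℂ (H t c) A]
  {κ : Type*} [Fintype κ] (w : κ → A)

/-- The combinations of the `w j` with coefficients in `I^k`, where `I` is the ideal of the origin
in `ℂ[V]`. -/
noncomputable def polySpan (k : ℕ) : Submodule ℂ A where
  carrier := {u | ∃ p : κ → MvPolynomial ι ℂ, (∀ j, p j ∈ MvPolynomial.idealOfVars ι ℂ ^ k) ∧
    u = ∑ j, polyHom t c b (p j) • w j}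
  add_mem' := by
    rintro _ _ ⟨p, hp, rfl⟩ ⟨q, hq, rfl⟩
    exact ⟨p + q, fun j => add_mem (hp j) (hq j), by
      simp [add_smul, Finset.sum_add_distrib]⟩
  zero_mem' := ⟨0, fun j => zero_mem _, by simp⟩
  smul_mem' := by
    rintro r _ ⟨p, hp, rfl⟩
    refine ⟨fun j => r • p j, fun j => ?_, ?_⟩
    · exact Submodule.smul_of_tower_mem _ r (hp j)
    · rw [Finset.smul_sum]
      simp only [map_smul, smul_assoc]

theorem polySpan_anti : Antitone (polySpan (t := t) (c := c) b w) := by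
  rintro k l hkl _ ⟨p, hp, rfl⟩
  exact ⟨p, fun j => Ideal.pow_le_pow_right hkl (hp j), rfl⟩

theorem smul_mem_polySpan {k l : ℕ} {q : MvPolynomial ι ℂ}
    (hq : q ∈ MvPolynomial.idealOfVars ι ℂ ^ k) {u : A}
    (hu : u ∈ polySpan (t := t) (c := c) b w l) :
    polyHom t c b q • u ∈ polySpan (t := t) (c := c) b w (k + l) := by
  obtain ⟨p, hp, rfl⟩ := hu
  refine ⟨fun j => q * p j, fun j => ?_, ?_⟩
  · rw [pow_add]; exact Ideal.mul_mem_mul hq (hp j)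
  · rw [Finset.smul_sum]
    simp only [map_mul, mul_smul]

theorem smul_gen_mem_polySpan (q : MvPolynomial ι ℂ) (j : κ) :
    polyHom t c b q • w j ∈ polySpan (t := t) (c := c) b w 0 := by
  classical
  refine ⟨Pi.single j q, fun i => by simp, ?_⟩
  rw [Finset.sum_eq_single j]
  · simp
  · intro i _ hi
    simp [hi]
  · simp

theorem gen_mem_polySpan (j : κ) : w j ∈ polySpan (t := t) (c := c) b w 0 := by
  have := smul_gen_mem_polySpan (t := t) (c := c) b w 1 j
  rwa [map_one, one_smul] at this

theorem xHom_smul_mem_polySpan [Fintype ι] (x : Module.Dual ℂ V) {l : ℕ} {u : A}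
    (hu : u ∈ polySpan (t := t) (c := c) b w l) :
    xHom t c x • u ∈ polySpan (t := t) (c := c) b w (l + 1) := by
  rw [xHom_eq_polyHom b, add_comm]
  refine smul_mem_polySpan b w ?_ hu
  rw [pow_one]
  exact Ideal.sum_mem _ fun i _ => Submodule.smul_of_tower_mem _ _ (Ideal.subset_span ⟨i, rfl⟩)

variable {b w} in
-- Pass to a subsequence whose successive differences have coefficients in growing powers of `I`,
-- and add these coefficients up to power series. It is applied both to `A = H`, to describe `H̃`,
-- and to a module of category `O`; `m` records the order of the coefficients.
theorem exists_sum_trunc [Fintype ι] {a : ℕ → A} {m : ℕ}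
    (ha : ∀ k, ∃ N, ∀ i ≥ N, ∀ j ≥ N, a i - a j ∈ polySpan (t := t) (c := c) b w k)
    (ham : ∃ N, ∀ i ≥ N, a i ∈ polySpan (t := t) (c := c) b w m) :
    ∃ f : κ → MvPowerSeries ι ℂ, (∀ j, f j ∈ MvPowerSeries.orderIdeal ι ℂ m) ∧
      ∀ k, ∃ N, ∀ i ≥ N, a i - ∑ j, polyHom t c b (MvPowerSeries.truncTotal i (f j)) • w j ∈
        polySpan (t := t) (c := c) b w k := by
  choose N hN using ha
  obtain ⟨N', hN'⟩ := ham
  -- The range `k + 2` makes `s k` at least `N (k + 1)`, so the difference `d (k + 1)` already lies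
  -- at level `k + 1`.
  let s : ℕ → ℕ := fun k => N' + ∑ i ∈ Finset.range (k + 2), N i
  have hs : ∀ k l, k ≤ l + 1 → N k ≤ s l := fun k l hkl =>
    (Finset.single_le_sum (f := N) (fun _ _ => Nat.zero_le _)
      (Finset.mem_range.2 (by omega : k < l + 2))).trans (Nat.le_add_left _ _)
  let d : ℕ → A := fun k => match k with
    | 0 => a (s 0)
    | k + 1 => a (s (k + 1)) - a (s k)
  have hd : ∀ k, d k ∈ polySpan (t := t) (c := c) b w (max k m) := by
    intro k
    have hm : ∀ l, a (s l) ∈ polySpan (t := t) (c := c) b w m := fun l => hN' _ (Nat.le_add_right _ _)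
    rcases k with _ | k
    · simpa using hm 0
    · rcases le_total (k + 1) m with h | h
      · rw [max_eq_right h]; exact sub_mem (hm _) (hm _)
      · rw [max_eq_left h]
        exact hN (k + 1) _ (hs _ _ (by omega)) _ (hs _ _ (by omega))
  have hsum : ∀ K, ∑ k ∈ Finset.range (K + 1), d k = a (s K) := by
    intro K
    induction K with
    | zero => simp [d]
    | succ K ih => rw [Finset.sum_range_succ, ih]; simp [d]
  choose p hp hpd using hd
  have hcoe : ∀ k j, ((p k j : MvPolynomial ι ℂ) : MvPowerSeries ι ℂ) ∈
      MvPowerSeries.orderIdeal ι ℂ (max k m) := fun k j e he => by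
    rw [MvPolynomial.coeff_coe]
    exact (MvPolynomial.mem_pow_idealOfVars_iff' _ _).1 (hp k j) e he
  choose f hf using fun j => MvPowerSeries.exists_sub_sum_mem
    (fun k => ((p k j : MvPolynomial ι ℂ) : MvPowerSeries ι ℂ))
    fun k => MvPowerSeries.orderIdeal_anti (le_max_left k m) (hcoe k j)
  refine ⟨f, fun j => ?_, fun K => ?_⟩
  · rw [← sub_add_cancel (f j) (∑ k ∈ Finset.range m, (p k j : MvPowerSeries ι ℂ))]
    exact add_mem (hf j m) (Ideal.sum_mem _ fun k _ =>
      MvPowerSeries.orderIdeal_anti (le_max_right k m) (hcoe k j))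
  -- Compare with `a (s K)`: its coefficients are the partial sums up to `K`, which agree with `f`
  -- in degrees at most `K`, and truncation at `i ≥ K + 1` keeps those degrees.
  · refine ⟨max (s K) (K + 1), fun i hi => ?_⟩
    rw [← sub_add_sub_cancel _ (a (s K))]
    refine add_mem (hN K _ ((hs K K (by omega)).trans (le_of_max_le_left hi)) _ (hs K K (by omega))) ?_
    refine polySpan_anti b w (Nat.le_succ K) ?_
    have h1 : a (s K) = ∑ j, polyHom t c b (∑ k ∈ Finset.range (K + 1), p k j) • w j := by
      rw [← hsum]
      simp only [map_sum, Finset.sum_smul, hpd]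
      exact Finset.sum_comm
    rw [h1, ← Finset.sum_sub_distrib]
    refine ⟨fun j => ∑ k ∈ Finset.range (K + 1), p k j - MvPowerSeries.truncTotal i (f j),
      fun j => ?_, by simp only [map_sub, sub_smul]⟩
    rw [MvPolynomial.mem_pow_idealOfVars_iff']
    intro e he
    have h2 := hf j (K + 1) e he
    rw [map_sub, map_sum, sub_eq_zero] at h2
    rw [MvPolynomial.coeff_sub, MvPowerSeries.coeff_truncTotal _
      (lt_of_lt_of_le he (le_of_max_le_right hi)), h2, MvPolynomial.coeff_sum, sub_eq_zero]
    exact Finset.sum_congr rfl fun k _ => (MvPolynomial.coeff_coe _ _).symm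

end PolySpan

/-! ### The completed algebra is generated by `ℂ[[V]]` and `H`. -/

section Completion

variable {V : Type u} [AddCommGroup V] [Module ℂ V] {G : Subgroup (V ≃ₗ[ℂ] V)} [Finite G]
  {t : ℂ} {c : Parameter G} {ι : Type*} [Fintype ι] (b : Module.Basis ι ℂ V)

omit [Fintype ι] in
theorem polySpan_le_IF {κ : Type*} [Fintype κ] {w : κ → H t c} {n : ℕ}
    (hw : ∀ j, w j ∈ F t c n) (k : ℕ) : polySpan (t := t) (c := c) b w k ≤ IF t c k n := by
  rintro _ ⟨p, hp, rfl⟩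
  refine sum_mem fun j _ => ?_
  have := IF_mul_F t c k 0 n
  rw [zero_add] at this
  rw [← this]
  exact Submodule.mul_mem_mul
    (polyHom_mem t c b _ _ ((MvPolynomial.mem_pow_idealOfVars_iff' _ _).1 (hp j))) (hw j)

/-- The same finite set of generators of `F^n` over `ℂ[V]` serves for all powers of `I`, which is
what makes the convergence argument applicable. -/
theorem exists_IF_le_polySpan (n : ℕ) : ∃ (m : ℕ) (w : Fin m → H t c), (∀ j, w j ∈ F t c n) ∧
    ∀ k, IF t c k n ≤ polySpan (t := t) (c := c) b w k := by
  obtain ⟨E, hE, hEF, hFE⟩ := exists_fg_F_le (t := t) (c := c) b n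
  obtain ⟨m, w, rfl⟩ := Submodule.fg_iff_exists_fin_generating_family.1 hE
  refine ⟨m, w, fun j => hEF (Submodule.subset_span ⟨j, rfl⟩), fun k => ?_⟩
  induction k with
  | zero =>
    rw [IF, pow_zero, one_mul]
    refine hFE.trans (Submodule.mul_le.2 ?_)
    rintro _ ⟨q, rfl⟩ u hu
    induction hu using Submodule.span_induction with
    | mem u hu =>
      obtain ⟨j, rfl⟩ := hu
      exact smul_gen_mem_polySpan b w q j
    | zero => rw [mul_zero]; exact zero_mem _
    | add x y _ _ hx hy => rw [mul_add]; exact add_mem hx hy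
    | smul r x _ hx => rw [mul_smul_comm]; exact Submodule.smul_mem _ r hx
  | succ k ih =>
    rw [IF, pow_succ', mul_assoc]
    refine (mul_le_mul' le_rfl ih).trans (Submodule.mul_le.2 ?_)
    rintro _ ⟨x, rfl⟩ u hu
    exact xHom_smul_mem_polySpan b w x hu

/-- The elements of `H̃` represented by a sequence in `I^k F^n` are combinations of elements of `H`
with coefficients of order at least `k` in `ℂ[[V]]`. -/
theorem exists_mk_eq_sum (a : cauchySeq t c) {k n : ℕ} (ha : ∃ N, ∀ i ≥ N, a.1 i ∈ IF t c k n) :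
    ∃ (m : ℕ) (f : Fin m → MvPowerSeries ι ℂ) (w : Fin m → H t c),
      (∀ j, f j ∈ MvPowerSeries.orderIdeal ι ℂ k) ∧
      HCompleted.mk t c a = ∑ j, powerSeriesHom t c b (f j) * toHCompleted t c (w j) := by
  obtain ⟨l, -, hl⟩ := a.2
  -- The Cauchy condition is known in `F^l`, the smallness in `F^n`; both are read in the larger
  -- step.
  obtain ⟨m, w, hw, hIF⟩ := exists_IF_le_polySpan (t := t) (c := c) b (max l n)
  obtain ⟨f, hf, hf'⟩ := exists_sum_trunc (a := a.1) (m := k) (w := w) (b := b)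
    (fun k => by
      obtain ⟨N, hN⟩ := hl k
      exact ⟨N, fun i hi j hj => hIF k (IF_mono t c (le_max_left _ _) (hN i hi j hj))⟩)
    (by
      obtain ⟨N, hN⟩ := ha
      exact ⟨N, fun i hi => hIF k (IF_mono t c (le_max_right _ _) (hN i hi))⟩)
  refine ⟨m, f, w, hf, ?_⟩
  have h1 : ∑ j, powerSeriesHom t c b (f j) * toHCompleted t c (w j) =
      HCompleted.mk t c (∑ j, truncSeq t c b (f j) * constSeq t c (w j)) := by
    rw [map_sum]
    exact Finset.sum_congr rfl fun j _ => (map_mul (HCompleted.mk t c) _ _).symm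
  rw [h1, HCompleted.mk_eq]
  refine ⟨max l n, fun K => ?_⟩
  obtain ⟨N, hN⟩ := hf' K
  refine ⟨N, fun i hi => polySpan_le_IF b hw K ?_⟩
  have h2 : (a - ∑ j, truncSeq t c b (f j) * constSeq t c (w j)).1 i =
      a.1 i - ∑ j, polyHom t c b (MvPowerSeries.truncTotal i (f j)) • w j := by
    rw [AddSubgroupClass.coe_sub, AddSubmonoidClass.coe_finsetSum, Pi.sub_apply,
      Finset.sum_apply]
    rfl
  rw [h2]
  exact hN i hi

theorem powerSeriesHom_X (i : ι) :
    powerSeriesHom t c b (MvPowerSeries.X i) = toHCompleted t c (xHom t c (b.coord i)) := by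
  refine (HCompleted.mk_eq t c).2 ⟨0, fun k => ⟨2, fun j hj => ?_⟩⟩
  have : (truncSeq t c b (MvPowerSeries.X i) - constSeq t c (xHom t c (b.coord i))).1 j = 0 := by
    show polyHom t c b (MvPowerSeries.truncTotal j (MvPowerSeries.X i)) - xHom t c (b.coord i) = 0
    rw [← MvPolynomial.coe_X, (MvPowerSeries.truncTotal_coe_eq_self_iff _ (by omega)).2
      (by rw [MvPolynomial.totalDegree_X]; omega), polyHom_X, sub_self]
  rw [this]; exact zero_mem _

theorem powerSeriesHom_C (r : ℂ) :
    powerSeriesHom t c b (MvPowerSeries.C r) = toHCompleted t c (algebraMap ℂ _ r) := by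
  refine (HCompleted.mk_eq t c).2 ⟨0, fun k => ⟨1, fun j hj => ?_⟩⟩
  have : (truncSeq t c b (MvPowerSeries.C r) - constSeq t c (algebraMap ℂ _ r)).1 j = 0 := by
    show polyHom t c b (MvPowerSeries.truncTotal j (MvPowerSeries.C r)) - algebraMap ℂ _ r = 0
    rw [← MvPolynomial.coe_C, (MvPowerSeries.truncTotal_coe_eq_self_iff _ (by omega)).2
      (by rw [MvPolynomial.totalDegree_C]; omega), ← MvPolynomial.algebraMap_eq, AlgHom.commutes,
      sub_self]
  rw [this]; exact zero_mem _

end Completion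

/-! ### Completions of modules from category `O` are finitely generated over `ℂ[[V]]`. -/

section CategoryO

variable {V : Type u} [AddCommGroup V] [Module ℂ V] {G : Subgroup (V ≃ₗ[ℂ] V)} [Finite G]
  {c : Parameter G} {ι : Type*} [Fintype ι] (b : Module.Basis ι ℂ V)
  {M : Type*} [AddCommGroup M] [Module ℂ M] [Module (H 1 c) M] [IsScalarTower ℂ (H 1 c) M]

variable (c) in
/-- The part of the Euler element in `ℂ[G]`. -/
noncomputable def eulerGroup : H 1 c :=
  algebraMap ℂ _ ((Module.finrank ℂ V : ℂ) * 1 / 2) -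
    ∑ s : reflections G, (2 * c.toFun s / (1 - eigenvalue s)) • gHom 1 c s.1

theorem euler_sub_eulerGroup :
    euler 1 c b - eulerGroup c = ∑ i, xHom 1 c (b.coord i) * yHom 1 c (b i) := by
  rw [euler, eulerGroup]; abel

theorem eulerGroup_mem : eulerGroup c ∈ groupSpan 1 c :=
  sub_mem (one_le_groupSpan (Submodule.mem_one.2 ⟨_, rfl⟩))
    (sum_mem fun s _ => Submodule.smul_mem _ _ (gHom_mem_groupSpan s.1))

theorem commute_euler_eulerGroup : Commute (euler 1 c b) (eulerGroup c) := by
  rw [eulerGroup]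
  refine Commute.sub_right (Algebra.commute_algebraMap_right _ _)
    (Commute.sum_right _ _ _ fun s _ => Commute.smul_right (euler_g 1 c b s.1) _)

variable (c) in
-- The element lies in the image of `ℂ[G]`, a finite dimensional subalgebra, so it is integral over
-- `ℂ`.
theorem exists_aeval_eulerGroup_eq_zero :
    ∃ Q : Polynomial ℂ, Q ≠ 0 ∧ Polynomial.aeval (eulerGroup c) Q = 0 := by
  let S : Subalgebra ℂ (H 1 c) := (groupSpan 1 c).toSubalgebra
    (one_le_groupSpan (Submodule.mem_one.2 ⟨1, map_one _⟩))
    fun x y hx hy => groupSpan_mul_groupSpan (Submodule.mul_mem_mul hx hy)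
  have hS : S.toSubmodule.FG := Submodule.fg_span (Set.finite_range _)
  obtain ⟨Q, hQ, hQ0⟩ := IsIntegral.of_mem_of_fg S hS (eulerGroup c) eulerGroup_mem
  exact ⟨Q, hQ.ne_zero, hQ0⟩

/-- For commuting elements `x - z` divides `p(x) - p(z)`. That the quotient commutes with `x` is
needed so that it preserves the generalized eigenspaces of `h`. -/
theorem exists_aeval_sub_aeval {A : Type*} [Ring A] [Algebra ℂ A] {x z : A} (hxz : Commute x z)
    (p : Polynomial ℂ) : ∃ r, Commute x r ∧
      Polynomial.aeval x p - Polynomial.aeval z p = (x - z) * r := by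
  induction p using Polynomial.induction_on with
  | C a => exact ⟨0, Commute.zero_right _, by simp⟩
  | add p q hp hq =>
    obtain ⟨r, hr, hp⟩ := hp
    obtain ⟨s, hs, hq⟩ := hq
    exact ⟨r + s, hr.add_right hs, by rw [mul_add, ← hp, ← hq, map_add, map_add]; abel⟩
  | monomial n a ih =>
    obtain ⟨r, hr, ih⟩ := ih
    rw [pow_succ, ← mul_assoc]
    generalize Polynomial.C a * Polynomial.X ^ n = p at *
    have hc : Commute x (Polynomial.aeval x p) := by
      nth_rw 1 [← Polynomial.aeval_X (R := ℂ) x]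
      exact (Commute.all _ p).map (Polynomial.aeval x)
    refine ⟨Polynomial.aeval x p + z * r, hc.add_right (hxz.mul_right hr), ?_⟩
    rw [mul_comm p, map_mul, map_mul, Polynomial.aeval_X, Polynomial.aeval_X,
      mul_add, ← mul_assoc, show (x - z) * z = z * (x - z) by
        rw [sub_mul, mul_sub, hxz.eq], mul_assoc, ← ih, sub_mul, mul_sub]
    abel

theorem smul_genEig_of_commute {a : H 1 c} (h : Commute (euler 1 c b) a) {l : ℂ} {u : M}
    (hu : u ∈ genEig c b M l) : a • u ∈ genEig c b M l := by
  have := smul_genEig c b (a := a) (d := 0) (by rw [zero_smul, add_zero]; exact h) hu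
  rwa [add_zero] at this

theorem exists_eq_sum_xHom_smul {Q : Polynomial ℂ}
    (hQ : Polynomial.aeval (eulerGroup c) Q = 0) {l : ℂ} (hl : ¬ Q.IsRoot l) {u : M}
    (hu : u ∈ genEig c b M l) :
    ∃ v : ι → M, (∀ i, v i ∈ genEig c b M (l - 1)) ∧ u = ∑ i, xHom 1 c (b.coord i) • v i := by
  obtain ⟨D, hD, hDu⟩ := exists_aeval_of_mem_maxGenEigenspace hu
  rw [Polynomial.aeval_algHom_apply] at hDu
  replace hDu : Polynomial.aeval (euler 1 c b) D • u = 0 := hDu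
  obtain ⟨p, q, hpq⟩ := isCoprime_of_forall_root (p := Q) (q := D) fun z hz hz' =>
    hl (hD z hz' ▸ hz)
  obtain ⟨r, hr, hQr⟩ := exists_aeval_sub_aeval (commute_euler_eulerGroup (c := c) b) Q
  rw [hQ, sub_zero] at hQr
  have hc : Commute (euler 1 c b) (Polynomial.aeval (euler 1 c b) p) := by
    nth_rw 1 [← Polynomial.aeval_X (R := ℂ) (euler 1 c b)]
    exact (Commute.all _ p).map (Polynomial.aeval (euler 1 c b))
  -- Since `p Q + q D = 1` and `D(h) u = 0`, one has `u = Q(h) p(h) u = (h - z) r p(h) u = ∑ x_i y_i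
  -- u'`, and each `y_i` lowers the eigenvalue by one.
  set u' : M := (r * Polynomial.aeval (euler 1 c b) p) • u
  have hu' : u' ∈ genEig c b M l := smul_genEig_of_commute b (hr.mul_right hc) hu
  have h1 : u = (euler 1 c b - eulerGroup c) • u' := by
    have h2 : u = Polynomial.aeval (euler 1 c b) (Q * p + q * D) • u := by
      rw [mul_comm Q, hpq, map_one, one_smul]
    rw [map_add, map_mul, map_mul, add_smul, mul_smul _ _ u, mul_smul _ _ u, hDu, smul_zero,
      add_zero, hQr, ← mul_smul, mul_assoc] at h2
    rw [← mul_smul]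
    exact h2
  refine ⟨fun i => yHom 1 c (b i) • u', fun i => ?_, ?_⟩
  · refine smul_genEig c b (d := -1) ?_ hu'
    rw [euler_y]; simp [sub_eq_add_neg]
  · rw [h1, euler_sub_eulerGroup, Finset.sum_smul]
    simp only [mul_smul]

theorem polySpan_le_geq {κ : Type*} [Fintype κ] (w : κ → M) {B : ℝ} (hB : geq c b M B = ⊤) (k : ℕ) :
    polySpan (t := 1) (c := c) b w k ≤ geq c b M (B + k) := by
  rintro _ ⟨p, hp, rfl⟩
  refine sum_mem fun j _ => ?_
  have := IF_le_shift c b (M := M) k 0 (polyHom_mem 1 c b _ _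
    ((MvPolynomial.mem_pow_idealOfVars_iff' _ _).1 (hp j))) B (w j) (hB ▸ Submodule.mem_top)
  simpa using this

/-- Generators `w` span the sum of the `M(l)` over the roots `l` of `Q`. At any other `l` one
descends to `l - 1` and gains a factor from `V*`; the descent stops at a root of `Q`, or below the
bound where `M(l) = 0`. -/
theorem IsCategoryO.exists_geq_le_polySpan (hM : IsCategoryO c b M) :
    ∃ (m : ℕ) (w : Fin m → M), polySpan (t := 1) (c := c) b w 0 = ⊤ ∧
      ∃ C : ℝ, ∀ k : ℕ, geq c b M (C + k) ≤ polySpan (t := 1) (c := c) b w k := by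
  obtain ⟨Q, hQ0, hQ⟩ := exists_aeval_eulerGroup_eq_zero c
  have hfin := Polynomial.finite_setOfPred_isRoot hQ0
  obtain ⟨C, hC⟩ := (hfin.image fun z : ℂ => z.re).bddAbove
  obtain ⟨B, hB⟩ := hM.bddBelow
  have hWfg : (⨆ l ∈ hfin.toFinset, genEig c b M l).FG :=
    Submodule.fg_biSup _ _ fun l _ => by
      have := hM.finite l
      exact Module.Finite.iff_fg.1 this
  obtain ⟨m, w, hw⟩ := Submodule.fg_iff_exists_fin_generating_family.1 hWfg
  have hW : ∀ l, Q.IsRoot l → genEig c b M l ≤ polySpan (t := 1) (c := c) b w 0 := by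
    intro l hl
    refine (le_iSup₂_of_le (f := fun l (_ : l ∈ hfin.toFinset) => genEig c b M l) l
      (hfin.mem_toFinset.2 hl) le_rfl).trans ?_
    rw [← hw, Submodule.span_le]
    rintro _ ⟨j, rfl⟩
    exact gen_mem_polySpan b w j
  -- Induction on the distance above the lower bound `B`. As `C` bounds the real parts of the roots,
  -- at least `l.re - C` descents occur before a root is reached; the maximum with `0` includes the
  -- plain generation statement `k = 0` for all `l`.
  have key : ∀ (n : ℕ) (l : ℂ), l.re < B + n → ∀ k : ℕ, (k : ℝ) ≤ max 0 (l.re - C) →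
      genEig c b M l ≤ polySpan (t := 1) (c := c) b w k := by
    intro n
    induction n with
    | zero =>
      intro l hl k _
      have : genEig c b M l = ⊥ := by
        by_contra h
        have := hB l h
        simp at hl
        linarith
      rw [this]; exact bot_le
    | succ n ih =>
      intro l hl k hk
      by_cases hroot : Q.IsRoot l
      · have h1 : l.re ≤ C := hC ⟨l, hroot, rfl⟩
        rw [max_eq_left (by linarith)] at hk
        have : k = 0 := by exact_mod_cast le_antisymm hk (Nat.cast_nonneg k)
        rw [this]
        exact hW l hroot
      · intro u hu
        obtain ⟨v, hv, rfl⟩ := exists_eq_sum_xHom_smul b hQ hroot hu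
        refine sum_mem fun i _ => ?_
        have hl' : (l - 1).re < B + n := by push_cast at hl; simp; linarith
        rcases k with _ | k
        · exact polySpan_anti b w (Nat.zero_le _) (xHom_smul_mem_polySpan b w _
            (ih (l - 1) hl' 0 (by simp) (hv i)))
        · refine xHom_smul_mem_polySpan b w _ (ih (l - 1) hl' k ?_ (hv i))
          rcases le_max_iff.1 hk with h | h
          · exact absurd h (not_le.2 (by positivity))
          · refine le_max_of_le_right ?_
            push_cast at h
            simp
            linarith
  have key' : ∀ (l : ℂ) (k : ℕ), (k : ℝ) ≤ max 0 (l.re - C) →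
      genEig c b M l ≤ polySpan (t := 1) (c := c) b w k := by
    intro l
    obtain ⟨n, hn⟩ := exists_nat_gt (l.re - B)
    exact key n l (by linarith)
  refine ⟨m, w, ?_, C, fun k => iSup₂_le fun l hl => key' l k (le_max_of_le_right (by linarith))⟩
  rw [← top_le_iff, ← hM.iSup_eq_top]
  exact iSup_le fun l => key' l 0 (by simp)

theorem finiteOverPowerSeries_iff (N : ModuleCat.{w} (HCompleted 1 c)) :
    finiteOverPowerSeries b c N ↔ ∃ (m : ℕ) (n : Fin m → N), ∀ x : N,
      ∃ f : Fin m → MvPowerSeries ι ℂ, x = ∑ j, powerSeriesHom 1 c b (f j) • n j := by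
  constructor
  · intro h
    obtain ⟨m, n, hn⟩ := Submodule.fg_iff_exists_fin_generating_family.1 h.fg_top
    refine ⟨m, n, fun x => ?_⟩
    obtain ⟨f, hf⟩ := (Submodule.mem_span_range_iff_exists_fun _).1
      (hn ▸ Submodule.mem_top : (show (ModuleCat.restrictScalars (powerSeriesHom 1 c b)).obj N
        from x) ∈ _)
    exact ⟨f, hf.symm⟩
  · rintro ⟨m, n, hn⟩
    refine ⟨Submodule.fg_iff_exists_fin_generating_family.2 ⟨m, n, ?_⟩⟩
    rw [eq_top_iff]
    intro x _
    obtain ⟨f, hf⟩ := hn x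
    exact (Submodule.mem_span_range_iff_exists_fun _).2 ⟨f, hf.symm⟩

noncomputable instance (hM : IsCategoryO c b M) : SMul (cauchySeq 1 c) (cauchySeqModule b hM) :=
  (cauchySeqModule b hM).module.toDistribMulAction.toSMul

/-- The class of a Cauchy sequence in the completion of `M`. -/
noncomputable def Completion.mk (hM : IsCategoryO c b M) :
    cauchySeqModule b hM →+ Completion b hM :=
  (nullSeqModule b hM).mkQ.toAddMonoidHom

theorem Completion.mk_surjective (hM : IsCategoryO c b M) :
    Function.Surjective (Completion.mk b hM) := Submodule.Quotient.mk_surjective _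

theorem Completion.mk_eq (hM : IsCategoryO c b M) {m m' : cauchySeqModule b hM} :
    Completion.mk b hM m = Completion.mk b hM m' ↔ m - m' ∈ nullSeqModule b hM :=
  Submodule.Quotient.eq _

theorem finiteOverPowerSeries_of_categoryO {N : ModuleCat.{w} (HCompleted 1 c)}
    (h : categoryO b c N) : finiteOverPowerSeries b c N := by
  obtain ⟨M, _, _, _, _, hM, ⟨e⟩⟩ := h
  obtain ⟨m, w, hw, C, hC⟩ := hM.exists_geq_le_polySpan
  obtain ⟨B, hB⟩ := hM.geq_eq_top
  let w' : Fin m → cauchySeqModule b hM := fun j => ⟨fun _ => w j, fun r => ⟨0, fun i _ k _ => by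
    rw [sub_self]; exact zero_mem _⟩⟩
  rw [finiteOverPowerSeries_iff]
  refine ⟨m, fun j => e.symm (Completion.mk b hM (w' j)), fun x => ?_⟩
  obtain ⟨u, hu⟩ := Completion.mk_surjective b hM (e x)
  obtain ⟨f, -, hf⟩ := exists_sum_trunc (a := u.1) (m := 0) (w := w) (b := b) (t := 1) (c := c)
    (fun k => by
      obtain ⟨N, hN⟩ := u.2 (C + k)
      exact ⟨N, fun i hi j hj => hC k (hN i hi j hj)⟩)
    ⟨0, fun i _ => hw ▸ Submodule.mem_top⟩
  refine ⟨f, ?_⟩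
  have h1 : Completion.mk b hM u =
      ∑ j, powerSeriesHom 1 c b (f j) • Completion.mk b hM (w' j) := by
    have h2 : ∑ j, powerSeriesHom 1 c b (f j) • Completion.mk b hM (w' j) =
        Completion.mk b hM (∑ j, truncSeq 1 c b (f j) • w' j) := by
      rw [map_sum]
      rfl
    rw [h2, Completion.mk_eq]
    intro r
    obtain ⟨k, hk⟩ := exists_nat_ge (r - B)
    obtain ⟨N, hN⟩ := hf k
    refine ⟨N, fun i hi => geq_anti c b (by linarith) (polySpan_le_geq b w hB k ?_)⟩
    have h3 : (u - ∑ j, truncSeq 1 c b (f j) • w' j).1 i =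
        u.1 i - ∑ j, polyHom 1 c b (MvPowerSeries.truncTotal i (f j)) • w j := by
      rw [AddSubgroupClass.coe_sub, AddSubmonoidClass.coe_finsetSum, Pi.sub_apply,
        Finset.sum_apply]
      rfl
    rw [h3]
    exact hN i hi
  apply e.injective
  rw [← hu, h1, map_sum]
  simp only [map_smul, LinearEquiv.apply_symm_apply]

end CategoryO

/-! ### The adic filtration of an `H`-module and the Euler element. -/

section AdicFiltration

variable {V : Type u} [AddCommGroup V] [Module ℂ V] {G : Subgroup (V ≃ₗ[ℂ] V)} [Finite G]
  (c : Parameter G) {ι : Type*} [Fintype ι] (b : Module.Basis ι ℂ V)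
  (N : Type*) [AddCommGroup N] [Module ℂ N] [Module (H 1 c) N] [IsScalarTower ℂ (H 1 c) N]

/-- The subspaces `I^k N` of an `H`-module `N`, where `I` is the ideal of the origin in `ℂ[V]`. -/
noncomputable def adic (k : ℕ) : Submodule ℂ N := X 1 c ^ k • ⊤

variable {c N}

theorem submodule_mul_smul (I J : Submodule ℂ (H 1 c)) (P : Submodule ℂ N) :
    (I * J) • P = I • J • P := Submodule.smul_assoc I J P

theorem adic_zero : adic c N 0 = ⊤ := by rw [adic, pow_zero, Submodule.one_smul]

theorem pow_smul_adic (k l : ℕ) : X 1 c ^ k • adic c N l = adic c N (k + l) := by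
  rw [adic, adic, pow_add, submodule_mul_smul]

theorem adic_anti : Antitone (adic c N) := by
  refine antitone_nat_of_succ_le fun k => ?_
  rw [← pow_smul_adic k 1]
  exact Submodule.smul_mono le_rfl le_top

theorem IF_smul_mem_adic {k n : ℕ} {a : H 1 c} (ha : a ∈ IF 1 c k n) (u : N) :
    a • u ∈ adic c N k := by
  have : IF 1 c k n • (⊤ : Submodule ℂ N) ≤ adic c N k := by
    rw [IF, submodule_mul_smul]
    exact Submodule.smul_mono le_rfl le_top
  exact this (Submodule.smul_mem_smul ha Submodule.mem_top)

/-- Each factor from `V` cancels at most one factor from `V*`, so an element of `F^n` lowers the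
adic level by at most `n`. -/
theorem F_smul_mem_adic {k n : ℕ} {a : H 1 c} (ha : a ∈ F 1 c n) {u : N}
    (hu : u ∈ adic c N (k + n)) : a • u ∈ adic c N k := by
  have h1 : F 1 c n * X 1 c ^ (k + n) ≤ IF 1 c k n := by
    calc F 1 c n * X 1 c ^ (k + n) = F 1 c n * (X 1 c ^ (k + n) * 1) := by rw [mul_one]
      _ ≤ F 1 c n * IF 1 c (k + n) 0 := mul_le_mul' le_rfl (mul_le_mul' le_rfl (one_mem_F 1 c 0))
      _ ≤ IF 1 c k (n + 0) := F_IF 1 c n k 0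
  have h2 : F 1 c n • adic c N (k + n) ≤ adic c N k := by
    rw [adic, ← submodule_mul_smul]
    exact Submodule.smul_le.2 fun a ha u _ => IF_smul_mem_adic (h1 ha) u
  exact h2 (Submodule.smul_mem_smul ha hu)

theorem X_smul_le (P : Submodule ℂ N) :
    X 1 c • P ≤ ⨆ i, P.map (Algebra.lsmul ℂ ℂ N (xHom 1 c (b.coord i))) := by
  rw [Submodule.smul_le]
  rintro _ ⟨x, rfl⟩ u hu
  rw [← Module.Basis.sum_dual_apply_smul_coord b x, map_sum, Finset.sum_smul]
  refine sum_mem fun i _ => ?_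
  rw [map_smul, smul_assoc]
  exact Submodule.smul_mem _ _ (Submodule.mem_iSup_of_mem i ⟨u, hu, rfl⟩)

theorem euler_mul_of_mem_pow {k : ℕ} {x : H 1 c} (hx : x ∈ X 1 c ^ k) :
    (euler 1 c b - algebraMap ℂ _ (k : ℂ)) * x = x * euler 1 c b := by
  induction k generalizing x with
  | zero =>
    obtain ⟨r, rfl⟩ := Submodule.mem_one.1 (by simpa using hx)
    simp [Algebra.commutes]
  | succ k ih =>
    rw [pow_succ'] at hx
    induction hx using Submodule.mul_induction_on' with
    | mem_mul_mem p hp q hq =>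
      obtain ⟨p, rfl⟩ := hp
      have h1 : (euler 1 c b - algebraMap ℂ _ ((k + 1 : ℕ) : ℂ)) * xHom 1 c p =
          xHom 1 c p * (euler 1 c b - algebraMap ℂ _ (k : ℂ)) := by
        rw [sub_mul, euler_x, mul_sub, Algebra.commutes, Nat.cast_succ, map_add, mul_add, map_one,
          mul_one, one_smul]
        abel
      rw [← mul_assoc, h1, mul_assoc, ih hq, mul_assoc]
    | add p _ q _ hp hq => rw [mul_add, add_mul, hp, hq]

/-- Transports an annihilating polynomial of `h` on `N / I N` to the `k`-th graded piece, shifted by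
`k`. -/
theorem aeval_euler_mul_of_mem_pow (P : Polynomial ℂ) {k : ℕ} {x : H 1 c} (hx : x ∈ X 1 c ^ k) :
    Polynomial.aeval (euler 1 c b) (P.comp (Polynomial.X - Polynomial.C (k : ℂ))) * x =
      x * Polynomial.aeval (euler 1 c b) P := by
  rw [Polynomial.aeval_comp, map_sub, Polynomial.aeval_X, Polynomial.aeval_C]
  induction P using Polynomial.induction_on' with
  | add p q hp hq => rw [map_add, map_add, add_mul, mul_add, hp, hq]
  | monomial n a =>
    rw [Polynomial.aeval_monomial, Polynomial.aeval_monomial, mul_assoc, ← mul_assoc x,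
      ← Algebra.commutes a x, mul_assoc]
    congr 1
    induction n with
    | zero => simp
    | succ n ih => rw [pow_succ, mul_assoc, euler_mul_of_mem_pow b hx, ← mul_assoc, ih, mul_assoc,
        ← pow_succ]

theorem aeval_lsmul_apply (a : H 1 c) (P : Polynomial ℂ) (u : N) :
    Polynomial.aeval (Algebra.lsmul ℂ ℂ N a) P u = Polynomial.aeval a P • u := by
  rw [Polynomial.aeval_algHom_apply]; rfl

theorem euler_smul_mem_adic {k : ℕ} {u : N} (hu : u ∈ adic c N k) :
    Algebra.lsmul ℂ ℂ N (euler 1 c b) u ∈ adic c N k := by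
  induction hu using Submodule.smul_induction_on' with
  | smul x hx v _ =>
    have h1 := euler_mul_of_mem_pow b hx
    rw [sub_mul, sub_eq_iff_eq_add] at h1
    show euler 1 c b • x • v ∈ _
    rw [← mul_smul, h1, add_smul, mul_smul, Algebra.commutes, mul_smul]
    exact add_mem (Submodule.smul_mem_smul hx Submodule.mem_top)
      (Submodule.smul_mem_smul hx Submodule.mem_top)
  | add x _ y _ hx hy => rw [map_add]; exact add_mem hx hy

-- Substitute `N = E' + I^k N` into `N = E + I N`; the space `V* E'` is finite dimensional because
-- `V*` is.
include b in
theorem exists_fg_sup_adic {E : Submodule ℂ N} (hE : E.FG) (hE' : E ⊔ adic c N 1 = ⊤) (k : ℕ) :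
    ∃ E' : Submodule ℂ N, E'.FG ∧ E' ⊔ adic c N k = ⊤ := by
  induction k with
  | zero => exact ⟨⊥, Submodule.fg_bot, by rw [adic_zero, sup_top_eq]⟩
  | succ k ih =>
    obtain ⟨E', hE1, hE2⟩ := ih
    refine ⟨E ⊔ ⨆ i, E'.map (Algebra.lsmul ℂ ℂ N (xHom 1 c (b.coord i))),
      hE.sup (Submodule.fg_iSup _ fun i => hE1.map _), ?_⟩
    rw [eq_top_iff, ← hE', sup_assoc]
    refine sup_le_sup le_rfl ?_
    calc adic c N 1 = X 1 c • (E' ⊔ adic c N k) := by rw [hE2, adic, pow_one]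
      _ = X 1 c • E' ⊔ X 1 c ^ 1 • adic c N k := by rw [Submodule.smul_sup, pow_one]
      _ ≤ _ := sup_le_sup (X_smul_le b E') (by rw [pow_smul_adic, add_comm])

theorem finiteDimensional_quotient_of_sup {E P : Submodule ℂ N} (hE : E.FG) (h : E ⊔ P = ⊤) :
    FiniteDimensional ℂ (N ⧸ P) := by
  refine ⟨?_⟩
  have h1 : E.map P.mkQ = ⊤ := by
    have h2 := congrArg (Submodule.map P.mkQ) h
    rwa [Submodule.map_sup, Submodule.map_top, Submodule.range_mkQ, Submodule.mkQ_map_self,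
      sup_bot_eq] at h2
  rw [← h1]
  exact hE.map _

/-- The polynomial is the minimal polynomial of `h` on the finite dimensional space `N / I N`. -/
theorem exists_isShiftFiltration {E : Submodule ℂ N} (hE : E.FG) (hE' : E ⊔ adic c N 1 = ⊤)
    (hsep : ∀ u : N, (∀ k, u ∈ adic c N k) → u = 0)
    (hcomp : ∀ u : ℕ → N, (∀ k, u (k + 1) - u k ∈ adic c N k) → ∃ v, ∀ k, v - u k ∈ adic c N k) :
    ∃ P, IsShiftFiltration (Algebra.lsmul ℂ ℂ N (euler 1 c b)) (adic c N) P := by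
  have hfin : ∀ k, FiniteDimensional ℂ (N ⧸ adic c N k) := fun k => by
    obtain ⟨E', h1, h2⟩ := exists_fg_sup_adic b hE hE' k
    exact finiteDimensional_quotient_of_sup h1 h2
  have hmaps : ∀ k, ∀ u ∈ adic c N k, Algebra.lsmul ℂ ℂ N (euler 1 c b) u ∈ adic c N k :=
    fun k u hu => euler_smul_mem_adic b hu
  let S : Module.End ℂ (N ⧸ adic c N 1) := (adic c N 1).mapQ (adic c N 1) _ (hmaps 1)
  have hS : ∀ u : N, Polynomial.aeval (euler 1 c b) (minpoly ℂ S) • u ∈ adic c N 1 := fun u => by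
    have h1 := aeval_mapQ_mkQ (hmaps 1) (minpoly ℂ S) u
    rw [minpoly.aeval, LinearMap.zero_apply, aeval_lsmul_apply] at h1
    exact (Submodule.Quotient.mk_eq_zero _).1 h1.symm
  refine ⟨minpoly ℂ S, adic_zero, adic_anti, hmaps, minpoly.ne_zero_of_finite ℂ S, ?_, hfin, hsep,
    hcomp⟩
  intro k u hu
  rw [aeval_lsmul_apply]
  induction hu using Submodule.smul_induction_on' with
  | smul x hx v _ =>
    rw [← mul_smul, aeval_euler_mul_of_mem_pow b _ hx, mul_smul, ← pow_smul_adic k 1]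
    exact Submodule.smul_mem_smul hx (hS v)
  | add x _ y _ hx hy => rw [smul_add]; exact add_mem hx hy

end AdicFiltration

/-! ### The adic filtration of a finitely generated `ℂ[[V]]`-module. -/

section FinitePowerSeries

variable {V : Type u} [AddCommGroup V] [Module ℂ V] {G : Subgroup (V ≃ₗ[ℂ] V)} [Finite G]
  {c : Parameter G} {ι : Type*} [Fintype ι] {b : Module.Basis ι ℂ V}
  {N : Type*} [AddCommGroup N] [Module ℂ N] [Module (H 1 c) N] [IsScalarTower ℂ (H 1 c) N]
  [Module (HCompleted 1 c) N] [Module (MvPowerSeries ι ℂ) N]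

variable (c b N) in
/-- The actions on `N` of `H` and of `ℂ[[V]]` are the restrictions of the action of `H̃`. -/
structure IsRestriction : Prop where
  toHCompleted_smul : ∀ (a : H 1 c) (u : N), toHCompleted 1 c a • u = a • u
  powerSeriesHom_smul : ∀ (f : MvPowerSeries ι ℂ) (u : N), powerSeriesHom 1 c b f • u = f • u

namespace IsRestriction

variable (h : IsRestriction c b N)

include h

omit [Module ℂ N] [IsScalarTower ℂ (H 1 c) N] in
theorem X_smul (i : ι) (u : N) :
    (MvPowerSeries.X i : MvPowerSeries ι ℂ) • u = xHom 1 c (b.coord i) • u := by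
  rw [← h.powerSeriesHom_smul, powerSeriesHom_X, h.toHCompleted_smul]

theorem C_smul (r : ℂ) (u : N) : (MvPowerSeries.C r : MvPowerSeries ι ℂ) • u = r • u := by
  rw [← h.powerSeriesHom_smul, powerSeriesHom_C, h.toHCompleted_smul, algebraMap_smul]

/-- Products of `k` linear forms generate the ideal of series of order at least `k`, and their power
series coefficients are absorbed into `N`. This opens the way to commutative algebra over `ℂ[[V]]`.
-/
theorem mem_adic_iff {k : ℕ} {u : N} : u ∈ adic c N k ↔
    u ∈ (MvPowerSeries.orderIdeal ι ℂ k • ⊤ : Submodule (MvPowerSeries ι ℂ) N) := by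
  rw [← MvPowerSeries.pow_span_X]
  induction k generalizing u with
  | zero => simp [adic_zero]
  | succ k ih =>
    rw [← Nat.add_comm 1 k, ← pow_smul_adic, pow_one, pow_add, Submodule.mul_smul, pow_one]
    constructor
    · intro hu
      induction hu using Submodule.smul_induction_on' with
      | smul x hx v hv =>
        obtain ⟨x, rfl⟩ := hx
        rw [← Module.Basis.sum_dual_apply_smul_coord b x, map_sum, Finset.sum_smul]
        refine sum_mem fun i _ => ?_
        rw [map_smul, smul_assoc, ← h.X_smul, ← h.C_smul]
        exact Submodule.smul_mem _ _ (Submodule.smul_mem_smul (Ideal.subset_span ⟨i, rfl⟩) (ih.1 hv))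
      | add x _ y _ hx hy => exact add_mem hx hy
    · intro hu
      induction hu using Submodule.smul_induction_on' with
      | smul r hr v hv =>
        obtain ⟨f, rfl⟩ := Ideal.mem_span_range_iff_exists_fun.1 hr
        rw [Finset.sum_smul]
        refine sum_mem fun i _ => ?_
        rw [mul_comm, mul_smul, h.X_smul]
        exact Submodule.smul_mem_smul ⟨_, rfl⟩ (ih.2 (Submodule.smul_mem _ _ hv))
      | add x _ y _ hx hy => exact add_mem hx hy

/-- Continuity of the `H̃`-action, which is not assumed: it follows from writing the element with
coefficients of high order on the left. -/
theorem mk_smul_mem_adic {a : cauchySeq 1 c} {k n : ℕ} (ha : ∃ K, ∀ i ≥ K, a.1 i ∈ IF 1 c k n)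
    (u : N) : HCompleted.mk 1 c a • u ∈ adic c N k := by
  obtain ⟨m, f, w, hf, ha'⟩ := exists_mk_eq_sum b a ha
  rw [ha', Finset.sum_smul, h.mem_adic_iff]
  refine sum_mem fun j _ => ?_
  rw [mul_smul, h.powerSeriesHom_smul]
  exact Submodule.smul_mem_smul (hf j) Submodule.mem_top

variable [Module.Finite (MvPowerSeries ι ℂ) N]

/-- Krull's intersection theorem for the local ring `ℂ[[V]]`. -/
theorem eq_zero_of_forall_mem_adic {u : N} (hu : ∀ k, u ∈ adic c N k) : u = 0 := by
  have hne : Ideal.span (Set.range (MvPowerSeries.X : ι → MvPowerSeries ι ℂ)) ≠ ⊤ := by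
    rw [← pow_one (Ideal.span _), MvPowerSeries.pow_span_X, Ne, Ideal.eq_top_iff_one]
    intro h1
    have := h1 0 (by simp)
    simp at this
  have := IsHausdorff.of_isLocalRing _ N hne
  refine this.haus' u fun k => ?_
  rw [SModEq.zero, MvPowerSeries.pow_span_X]
  exact h.mem_adic_iff.1 (hu k)

/-- Write the differences in terms of finitely many generators with coefficients of order at least
`k`, and sum the coefficients in `ℂ[[V]]`. -/
theorem exists_forall_sub_mem_adic (u : ℕ → N) (hu : ∀ k, u (k + 1) - u k ∈ adic c N k) :
    ∃ v, ∀ k, v - u k ∈ adic c N k := by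
  obtain ⟨m, n, hn⟩ := Submodule.fg_iff_exists_fin_generating_family.1
    (Module.Finite.fg_top (R := MvPowerSeries ι ℂ) (M := N))
  have h1 : ∀ k, ∃ p : Fin m → MvPowerSeries ι ℂ, (∀ j, p j ∈ MvPowerSeries.orderIdeal ι ℂ k) ∧
      u (k + 1) - u k = ∑ j, p j • n j := fun k => by
    have h2 := h.mem_adic_iff.1 (hu k)
    rw [← hn, Submodule.mem_ideal_smul_span_iff_exists_sum] at h2
    obtain ⟨p, hp, h2⟩ := h2
    exact ⟨p, hp, by rw [← h2, Finsupp.sum_fintype _ _ (by simp)]⟩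
  choose p hp hpu using h1
  choose f hf using fun j => MvPowerSeries.exists_sub_sum_mem (fun k => p k j) fun k => hp k j
  refine ⟨u 0 + ∑ j, f j • n j, fun K => ?_⟩
  have h2 : u 0 + ∑ j, f j • n j - u K =
      ∑ j, (f j - ∑ k ∈ Finset.range K, p k j) • n j := by
    have h3 : u K - u 0 = ∑ j, (∑ k ∈ Finset.range K, p k j) • n j := by
      rw [← Finset.sum_range_sub, Finset.sum_congr rfl fun k _ => hpu k, Finset.sum_comm]
      simp only [Finset.sum_smul]
    simp only [sub_smul, Finset.sum_sub_distrib, ← h3]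
    abel
  rw [h2, h.mem_adic_iff]
  exact sum_mem fun j _ => Submodule.smul_mem_smul (hf j K) Submodule.mem_top

theorem exists_isShiftFiltration :
    ∃ P, IsShiftFiltration (Algebra.lsmul ℂ ℂ N (euler 1 c b)) (adic c N) P := by
  obtain ⟨m, n, hn⟩ := Submodule.fg_iff_exists_fin_generating_family.1
    (Module.Finite.fg_top (R := MvPowerSeries ι ℂ) (M := N))
  refine Cherednik.exists_isShiftFiltration b (E := Submodule.span ℂ (Set.range n))
    (Submodule.fg_span (Set.finite_range n)) ?_ (fun u => h.eq_zero_of_forall_mem_adic)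
    h.exists_forall_sub_mem_adic
  rw [eq_top_iff]
  intro u _
  obtain ⟨f, rfl⟩ := (Submodule.mem_span_range_iff_exists_fun _).1
    (hn ▸ Submodule.mem_top : u ∈ Submodule.span (MvPowerSeries ι ℂ) (Set.range n))
  refine sum_mem fun j _ => ?_
  -- Constant terms contribute to the complex span of the generators; the remainders have order at
  -- least one and contribute to `I N`.
  rw [← add_sub_cancel (MvPowerSeries.C (MvPowerSeries.constantCoeff (f j))) (f j), add_smul,
    h.C_smul]
  refine Submodule.add_mem_sup (Submodule.smul_mem _ _ (Submodule.subset_span ⟨j, rfl⟩)) ?_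
  rw [h.mem_adic_iff]
  refine Submodule.smul_mem_smul (fun e he => ?_) Submodule.mem_top
  have : e = 0 := by
    rw [← Finsupp.degree_eq_zero_iff]; omega
  rw [this, map_sub]
  simp

end IsRestriction

end FinitePowerSeries

/-! ### The submodule spanned by the generalized eigenvectors. -/

section EulerFinite

variable {V : Type u} [AddCommGroup V] [Module ℂ V] {G : Subgroup (V ≃ₗ[ℂ] V)} [Finite G]
  (c : Parameter G) {ι : Type*} [Fintype ι] (b : Module.Basis ι ℂ V)
  (N : Type*) [AddCommGroup N] [Module ℂ N] [Module (H 1 c) N] [IsScalarTower ℂ (H 1 c) N]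

/-- The `H`-submodule of `N` spanned by the generalized eigenvectors of the Euler element. -/
noncomputable def eulerFinite : Submodule (H 1 c) N where
  carrier := (⨆ l, genEig c b N l : Submodule ℂ N)
  add_mem' := add_mem
  zero_mem' := zero_mem _
  smul_mem' := by
    have key : ∀ (a : H 1 c) (d : ℂ), euler 1 c b * a = a * euler 1 c b + d • a →
        ∀ u ∈ (⨆ l, genEig c b N l : Submodule ℂ N),
          a • u ∈ (⨆ l, genEig c b N l : Submodule ℂ N) := by
      intro a d had u hu
      induction hu using Submodule.iSup_induction' with
      | zero => rw [smul_zero]; exact zero_mem _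
      | add x y _ _ hx hy => rw [smul_add]; exact add_mem hx hy
      | mem l u hu => exact Submodule.mem_iSup_of_mem _ (smul_genEig c b had hu)
    intro a
    induction a using H_induction with
    | hC r => exact fun {u} hu => key _ 0 (by rw [zero_smul, add_zero, Algebra.commutes]) u hu
    | hg g => exact fun {u} hu => key _ 0 (by rw [zero_smul, add_zero, euler_g]) u hu
    | hy y => exact fun {u} hu => key _ (-1) (by rw [euler_y]; simp [sub_eq_add_neg]) u hu
    | hx x => exact fun {u} hu => key _ 1 (euler_x 1 c b x) u hu
    | hadd p q hp hq => exact fun {u} hu => by rw [add_smul]; exact add_mem (hp hu) (hq hu)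
    | hmul p q hp hq => exact fun {u} hu => by rw [mul_smul]; exact hp (hq hu)

variable {c N}

theorem mem_eulerFinite {u : N} : u ∈ eulerFinite c b N ↔ u ∈ ⨆ l, genEig c b N l := Iff.rfl

theorem genEig_le_eulerFinite {l : ℂ} {u : N} (hu : u ∈ genEig c b N l) : u ∈ eulerFinite c b N :=
  (mem_eulerFinite b).2 (Submodule.mem_iSup_of_mem l hu)

theorem mem_genEig_submodule {P : Submodule (H 1 c) N} {l : ℂ} {u : P} :
    u ∈ genEig c b P l ↔ (u : N) ∈ genEig c b N l := by
  have key : ∀ (k : ℕ) (u : P), ((((Algebra.lsmul ℂ ℂ P (euler 1 c b) -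
      l • (1 : Module.End ℂ P)) ^ k) u : P) : N) =
      ((Algebra.lsmul ℂ ℂ N (euler 1 c b) - l • (1 : Module.End ℂ N)) ^ k) (u : N) := by
    intro k
    induction k with
    | zero => intro u; simp
    | succ k ih =>
      intro u
      rw [pow_succ, pow_succ, Module.End.mul_apply, Module.End.mul_apply, ih]
      rfl
  rw [genEig, genEig, Module.End.mem_maxGenEigenspace, Module.End.mem_maxGenEigenspace]
  refine exists_congr fun k => ?_
  rw [← key, ZeroMemClass.coe_eq_zero]

/-- All generalized eigenvectors of `N` lie in the submodule, so its eigenspaces are those of `N`.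
The predicate `Z` covers both the full sum and the sums over half-planes. -/
theorem mem_iSup_genEig_eulerFinite {Z : ℂ → Prop} {u : eulerFinite c b N} :
    u ∈ ⨆ (l : ℂ) (_ : Z l), genEig c b (eulerFinite c b N) l ↔
      (u : N) ∈ ⨆ (l : ℂ) (_ : Z l), genEig c b N l := by
  let j : eulerFinite c b N →ₗ[ℂ] N := (eulerFinite c b N).subtype.restrictScalars ℂ
  have hj : ∀ l, (genEig c b (eulerFinite c b N) l).map j = genEig c b N l := by
    intro l
    ext v
    constructor
    · rintro ⟨v, hv, rfl⟩
      exact (mem_genEig_submodule b).1 hv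
    · intro hv
      exact ⟨⟨v, genEig_le_eulerFinite b hv⟩, (mem_genEig_submodule b).2 hv, rfl⟩
  have h1 : (⨆ (l : ℂ) (_ : Z l), genEig c b (eulerFinite c b N) l).map j =
      ⨆ (l : ℂ) (_ : Z l), genEig c b N l := by
    simp only [Submodule.map_iSup, hj]
  rw [← h1]
  constructor
  · exact fun hu => ⟨u, hu, rfl⟩
  · rintro ⟨v, hv, hvu⟩
    rwa [← Subtype.ext (a1 := v) (a2 := u) hvu]

theorem mem_geq_eulerFinite {r : ℝ} {u : eulerFinite c b N} :
    u ∈ geq c b (eulerFinite c b N) r ↔ (u : N) ∈ geq c b N r := mem_iSup_genEig_eulerFinite b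

theorem isCategoryO_eulerFinite {F : ℕ → Submodule ℂ N} {P : Polynomial ℂ}
    (h : IsShiftFiltration (Algebra.lsmul ℂ ℂ N (euler 1 c b)) F P) :
    IsCategoryO c b (eulerFinite c b N) := by
  refine ⟨?_, fun l => ?_, ?_⟩
  · rw [eq_top_iff]
    intro u _
    have h1 := (mem_iSup_genEig_eulerFinite b (Z := fun _ => True) (u := u)).2 
      (by simp only [iSup_pos]; exact u.2)
    simpa using h1
  · have : FiniteDimensional ℂ (genEig c b N l) := h.finiteDimensional_maxGenEigenspace l
    refine FiniteDimensional.of_injective (V₂ := genEig c b N l)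
      ((((eulerFinite c b N).subtype.restrictScalars ℂ).comp
        (genEig c b (eulerFinite c b N) l).subtype).codRestrict (genEig c b N l)
        fun u => (mem_genEig_submodule b).1 u.2) ?_
    intro u v huv
    exact Subtype.ext (Subtype.ext (Subtype.ext_iff.1 huv :))
  · obtain ⟨r, hr⟩ := h.exists_le_re
    refine ⟨r, fun l hl => hr l fun h0 => hl ?_⟩
    rw [Submodule.eq_bot_iff]
    intro u hu
    have h1 : (u : N) ∈ genEig c b N l := (mem_genEig_submodule b).1 hu
    rw [genEig, h0, Submodule.mem_bot] at h1
    exact Subtype.ext h1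

end EulerFinite

/-! ### Limits in the adic topology. -/

section Limit

variable {V : Type u} [AddCommGroup V] [Module ℂ V] {G : Subgroup (V ≃ₗ[ℂ] V)} [Finite G]
  {c : Parameter G} {ι : Type*} [Fintype ι] {b : Module.Basis ι ℂ V}
  {N : Type*} [AddCommGroup N] [Module ℂ N] [Module (H 1 c) N] [IsScalarTower ℂ (H 1 c) N]

/-- `v` is the limit of the sequence `m` in the `I`-adic topology. -/
def IsAdicLimit (m : ℕ → N) (v : N) : Prop := ∀ k, ∃ K, ∀ i ≥ K, v - m i ∈ adic c N k

theorem IsAdicLimit.add {m m' : ℕ → N} {v v' : N} (h : IsAdicLimit (c := c) m v)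
    (h' : IsAdicLimit (c := c) m' v') : IsAdicLimit (c := c) (m + m') (v + v') := by
  intro k
  obtain ⟨K, hK⟩ := h k
  obtain ⟨K', hK'⟩ := h' k
  refine ⟨max K K', fun i hi => ?_⟩
  rw [Pi.add_apply, add_sub_add_comm]
  exact add_mem (hK i (le_of_max_le_left hi)) (hK' i (le_of_max_le_right hi))

theorem IsAdicLimit.smul [Module (HCompleted 1 c) N] [Module (MvPowerSeries ι ℂ) N]
    (hN : IsRestriction c b N) {m : ℕ → N} {v : N} (h : IsAdicLimit (c := c) m v)
    (a : cauchySeq 1 c) :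
    IsAdicLimit (c := c) (fun i => a.1 i • m i) (HCompleted.mk 1 c a • v) := by
  obtain ⟨n, ha, ha'⟩ := a.2
  intro k
  obtain ⟨K, hK⟩ := ha' k
  obtain ⟨K', hK'⟩ := h (k + n)
  refine ⟨max K K', fun i hi => ?_⟩
  -- The first term is small since `a` minus its `i`-th entry is represented by small differences.
  -- The second is small since `a i ∈ F^n` costs at most `n` levels, whence the `k + n` above.
  have h1 : HCompleted.mk 1 c a • v - a.1 i • m i =
      HCompleted.mk 1 c (a - constSeq 1 c (a.1 i)) • v + a.1 i • (v - m i) := by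
    rw [map_sub, sub_smul, smul_sub, ← hN.toHCompleted_smul (a.1 i) v]
    show _ = _ - toHCompleted 1 c (a.1 i) • v + _
    abel
  rw [h1]
  refine add_mem (hN.mk_smul_mem_adic (n := n) ⟨K, fun j hj => ?_⟩ v)
    (F_smul_mem_adic (ha i) (hK' i (le_of_max_le_right hi)))
  exact hK j hj i (le_of_max_le_left hi)

end Limit

/-! ### The completion of the submodule of generalized eigenvectors is the original module. -/

section Equivalence

variable {V : Type u} [AddCommGroup V] [Module ℂ V] {G : Subgroup (V ≃ₗ[ℂ] V)} [Finite G]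
  {c : Parameter G} {ι : Type*} [Fintype ι] {b : Module.Basis ι ℂ V}
  {N : Type*} [AddCommGroup N] [Module ℂ N] [Module (H 1 c) N] [IsScalarTower ℂ (H 1 c) N]
  [Module (HCompleted 1 c) N] [Module (MvPowerSeries ι ℂ) N]

/-- The isomorphism sends `v` to the class of any sequence of `M` converging adically to `v`, where
`M` is the span of the generalized eigenvectors. -/
theorem nonempty_linearEquiv_completion (hN : IsRestriction c b N) {P : Polynomial ℂ}
    (h : IsShiftFiltration (Algebra.lsmul ℂ ℂ N (euler 1 c b)) (adic c N) P)
    (hM : IsCategoryO c b (eulerFinite c b N)) :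
    Nonempty (N ≃ₗ[HCompleted 1 c] Completion b hM) := by
  obtain ⟨s, hs⟩ := h.exists_iSup_le
  obtain ⟨s', hs'⟩ := h.exists_inf_le
  -- Together `hs` and `hs'` say that on `M` the eigenvalue filtration and the adic filtration
  -- induced from `N` define the same topology.
  replace hs : ∀ (k : ℕ) {u : eulerFinite c b N}, u ∈ geq c b (eulerFinite c b N) (s + k) →
      (u : N) ∈ adic c N k := fun k u hu => hs k _ le_rfl ((mem_geq_eulerFinite b).1 hu)
  replace hs' : ∀ (r : ℝ), ∃ k : ℕ, ∀ u : eulerFinite c b N, (u : N) ∈ adic c N k →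
      u ∈ geq c b (eulerFinite c b N) r := fun r => by
    obtain ⟨k, hk⟩ := exists_nat_ge (r - s')
    exact ⟨k, fun u hu => (mem_geq_eulerFinite b).2 (hs' k r (by linarith) ⟨u.2, hu⟩)⟩
  -- The facts below show that this relation, modulo null sequences, is the graph of an `H̃`-linear
  -- bijection: density gives a sequence for each `v`, completeness a limit for each sequence, and
  -- separatedness uniqueness.
  let lim (m : cauchySeqModule b hM) (v : N) : Prop :=
    IsAdicLimit (c := c) (fun i => (m.1 i : N)) v
  have hlim_exists : ∀ v, ∃ m, lim m v := by
    intro v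
    have h1 : ∀ k, ∃ u : eulerFinite c b N, v - u ∈ adic c N k := fun k => by
      obtain ⟨u, hu, w, hw, huw⟩ := Submodule.mem_sup.1
        (h.iSup_maxGenEigenspace_sup k ▸ Submodule.mem_top : v ∈ _)
      exact ⟨⟨u, hu⟩, by rw [← huw]; simpa using hw⟩
    choose m hm using h1
    refine ⟨⟨m, fun r => ?_⟩, fun k => ⟨k, fun i hi => h.anti hi (hm i)⟩⟩
    obtain ⟨k, hk⟩ := hs' r
    refine ⟨k, fun i hi j hj => hk _ ?_⟩
    have := sub_mem (h.anti hj (hm j)) (h.anti hi (hm i))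
    simpa using this
  have hlim_zero : ∀ m v, lim m v → (Completion.mk b hM m = 0 ↔ v = 0) := by
    intro m v hmv
    rw [← map_zero (Completion.mk b hM), Completion.mk_eq, sub_zero]
    constructor
    · intro hm
      refine h.separated v fun k => ?_
      obtain ⟨K, hK⟩ := hmv k
      obtain ⟨K', hK'⟩ := hm (s + k)
      have := add_mem (hK (max K K') (le_max_left _ _)) (hs k (hK' (max K K') (le_max_right _ _)))
      rwa [sub_add_cancel] at this
    · rintro rfl r
      obtain ⟨k, hk⟩ := hs' r
      obtain ⟨K, hK⟩ := hmv k
      exact ⟨K, fun i hi => hk _ (by simpa using hK i hi)⟩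
  have hlim_add : ∀ m m' v v', lim m v → lim m' v' → lim (m + m') (v + v') :=
    fun m m' v v' h1 h2 => h1.add h2
  have hlim_smul : ∀ (a : cauchySeq 1 c) m v, lim m v → lim (a • m) (HCompleted.mk 1 c a • v) :=
    fun a m v h1 => h1.smul hN a
  have hlim_surj : ∀ m, ∃ v, lim m v := by
    intro m
    have h1 : ∀ k : ℕ, ∃ K, ∀ i ≥ K, ∀ j ≥ K, (m.1 i : N) - m.1 j ∈ adic c N k := fun k => by
      obtain ⟨K, hK⟩ := m.2 (s + k)
      exact ⟨K, fun i hi j hj => hs k (hK i hi j hj)⟩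
    choose K hK using h1
    -- A subsequence index dominating `K 0, …, K k`, so that successive terms differ by an element
    -- of level `k`.
    let ν : ℕ → ℕ := fun k => ∑ i ∈ Finset.range (k + 1), K i
    have hν : ∀ k l, k ≤ l → K k ≤ ν l := fun k l hkl =>
      Finset.single_le_sum (f := K) (fun _ _ => Nat.zero_le _)
        (Finset.mem_range.2 (Nat.lt_succ_of_le hkl))
    obtain ⟨v, hv⟩ := h.complete (fun k => m.1 (ν k))
      fun k => hK k _ (hν _ _ (Nat.le_succ k)) _ (hν _ _ le_rfl)
    refine ⟨v, fun k => ⟨K k, fun i hi => ?_⟩⟩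
    rw [← sub_add_sub_cancel v (m.1 (ν k) : N)]
    exact add_mem (hv k) (hK k _ (hν _ _ le_rfl) _ hi)
  have hlim_sub : ∀ m m' v v', lim m v → lim m' v' →
      (Completion.mk b hM m = Completion.mk b hM m' ↔ v = v') := by
    intro m m' v v' h1 h2
    have h3 := hlim_smul (-1) m' v' h2
    rw [map_neg, map_one, neg_smul, one_smul, neg_smul, one_smul] at h3
    have h4 := hlim_zero _ _ (hlim_add _ _ _ _ h1 h3)
    rwa [map_add, map_neg, add_neg_eq_zero, add_neg_eq_zero] at h4
  choose σ hσ using hlim_exists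
  let Φ : N →ₗ[HCompleted 1 c] Completion b hM :=
    { toFun := fun v => Completion.mk b hM (σ v)
      map_add' := fun v v' => by
        rw [← map_add]
        exact (hlim_sub _ _ _ _ (hσ _) (hlim_add _ _ _ _ (hσ v) (hσ v'))).2 rfl
      map_smul' := fun x v => by
        obtain ⟨a, rfl⟩ := Ideal.Quotient.mk_surjective x
        exact (hlim_sub _ _ _ _ (hσ _) (hlim_smul a _ _ (hσ v))).2 rfl }
  refine ⟨LinearEquiv.ofBijective Φ ⟨fun v v' hvv => ?_, fun x => ?_⟩⟩
  · exact (hlim_sub _ _ _ _ (hσ v) (hσ v')).1 hvv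
  · obtain ⟨m, rfl⟩ := Completion.mk_surjective b hM x
    obtain ⟨v, hv⟩ := hlim_surj m
    exact ⟨v, (hlim_sub _ _ _ _ (hσ v) hv).2 rfl⟩

theorem categoryO_of_finiteOverPowerSeries (b : Module.Basis ι ℂ V)
    {N : ModuleCat.{w} (HCompleted 1 c)} (hN : finiteOverPowerSeries b c N) :
    categoryO b c N := by
  -- The scalars `ℂ`, `H` and `ℂ[[V]]` all act by restriction from `H̃`, with `ℂ` acting through
  -- `H`, so the compatibilities hold by definition.
  let _ : Module (H 1 c) N := Module.compHom N (toHCompleted 1 c)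
  let _ : Module ℂ N := Module.compHom N (algebraMap ℂ (H 1 c))
  let _ : Module (MvPowerSeries ι ℂ) N := Module.compHom N (powerSeriesHom 1 c b)
  have : IsScalarTower ℂ (H 1 c) N := IsScalarTower.of_algebraMap_smul fun _ _ => rfl
  have : Module.Finite (MvPowerSeries ι ℂ) N := hN
  have hres : IsRestriction c b N := ⟨fun _ _ => rfl, fun _ _ => rfl⟩
  obtain ⟨P, hP⟩ := hres.exists_isShiftFiltration
  have hM := isCategoryO_eulerFinite b hP
  exact ⟨eulerFinite c b N, inferInstance, inferInstance, inferInstance, inferInstance, hM,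
    nonempty_linearEquiv_completion hres hP hM⟩

end Equivalence

end Cherednik

theorem mainTheorem9 {V : Type u} [AddCommGroup V] [Module ℂ V] {ι : Type v} [Fintype ι]
    (b : Module.Basis ι ℂ V) (G : Subgroup (V ≃ₗ[ℂ] V)) [Finite G]
    (c : Cherednik.Parameter G) :
    (Cherednik.categoryO b c :
      CategoryTheory.ObjectProperty (ModuleCat.{w} (Cherednik.HCompleted 1 c))) =
      Cherednik.finiteOverPowerSeries b c := by
  ext N
  exact ⟨Cherednik.finiteOverPowerSeries_of_categoryO b,
    Cherednik.categoryO_of_finiteOverPowerSeries b⟩
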